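/- Consider the traditional (Curry-style) presentation of Kernel $F^\omega_\le$. Kinds are $K ::= \star \mid K\to K$; types are $A ::= X \mid T_\star \mid A\to A \mid \forall X\le A{:}K.\,A \mid \Lambda X{:}K.\,A \mid A(A)$, identified up to renaming of bound variables; contexts are finite sequences of declarations $X\le A{:}K$. Put $T_{K\to K'}=\Lambda X{:}K.\,T_{K'}$, and let $X{:}K$ in a context abbreviate $X\le T_K{:}K$. Let $\triangleright$ be one-step $\beta$-reduction (the compatible closure, in all positions, of $(\Lambda X{:}K.\,A)(B)\triangleright A[B/X]$), let $=_\beta$ be the equivalence relation it generates, and call $A$ strongly normalizing if it has no infinite $\triangleright$-reduction sequence (inductively: every $B$ with $A\triangleright B$ is strongly normalizing). Kinding $\Gamma\vdash_T A:K$ is generated by the following rules, where "$\Gamma$ ok" means $\Gamma\vdash_T T_\star:\star$: - $()\vdash_T T_\star:\star$; if $\Gamma\vdash_T A:K$ and $X\notin\mathrm{dom}(\Gamma)$ then $\Gamma,X\le A{:}K\vdash_T T_\star:\star$; - if $\Gamma$ ok and $X\le A{:}K\in\Gamma$ then $\Gamma\vdash_T X:K$; - if $\Gamma,X{:}K\vdash_T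 A:K'$ then $\Gamma\vdash_T \Lambda X{:}K.\,A:K\to K'$; - if $\Gamma\vdash_T A:K\to K'$ and $\Gamma\vdash_T B:K$ then $\Gamma\vdash_T A(B):K'$; - if $\Gamma\vdash_T A:\star$ and $\Gamma\vdash_T B:\star$ then $\Gamma\vdash_T A\to B:\star$; - if $\Gamma,X\le A{:}K\vdash_T B:\star$ then $\Gamma\vdash_T\forall X\le A{:}K.\,B:\star$. Subtyping $\Gamma\vdash_T A\le B$ is generated by: - if $\Gamma\vdash_T A:K$, $\Gamma\vdash_T B:K$ and $A=_\beta B$ then $\Gamma\vdash_T A\le B$; - if $\Gamma\vdash_T A\le B$ and $\Gamma\vdash_T B\le C$ then $\Gamma\vdash_T A\le C$; - if $\Gamma\vdash_T A:K$ then $\Gamma\vdash_T A\le T_K$; - if $\Gamma$ ok and $X\le A{:}K\in\Gamma$ then $\Gamma\vdash_T X\le A$; - if $\Gamma,X{:}K\vdash_T A\le B$ then $\Gamma\vdash_T\Lambda X{:}K.\,A\le\Lambda X{:}K.\,B$; - if $\Gamma\vdash_T A\le B$ and $\Gamma\vdash_T A(C):K$ then $\Gamma\vdash_T A(C)\le B(C)$;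 - if $\Gamma\vdash_T B_1\le A_1$, $\Gamma\vdash_T A_2\le B_2$ and $\Gamma\vdash_T A_1\to A_2:\star$ then $\Gamma\vdash_T A_1\to A_2\le B_1\to B_2$; - if $\Gamma,X\le A{:}K\vdash_T B\le D$ and $\Gamma\vdash_T\forall X\le A{:}K.\,B:\star$ then $\Gamma\vdash_T\forall X\le A{:}K.\,B\le\forall X\le A{:}K.\,D$. Write $\Gamma\vdash_T A\le B:K$ if $\Gamma\vdash_T A\le B$, $\Gamma\vdash_T A:K$ and $\Gamma\vdash_T B:K$. Then: 1. If $\Gamma\vdash_T A:K$, then $A$ is strongly normalizing. 2. Kinding and subtyping are decidable: there is an algorithm that, given $\Gamma,A,K$, decides whether $\Gamma\vdash_T A:K$, and there is an algorithm that, given $\Gamma,A,B,K$, decides whether $\Gamma\vdash_T A\le B:K$. 3. If $\Gamma\vdash_T A\le B$, $\Gamma\vdash_T B\le A$, $\Gamma\vdash_T A:K$ and $\Gamma\vdash_T B:K$, then $A=_\beta B$. -/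

import Mathlib

namespace FOmegaSub

/-- Kinds: `⋆` and `K → K'`. -/
inductive Knd : Type
  | star : Knd
  | arr : Knd → Knd → Knd
  deriving DecidableEq

/-- Types of the traditional (Curry-style) system, up to renaming of bound variables: variables are
de Bruijn indices and carry no bound. `all K A B` is `∀ X ≤ A : K. B` and `lam K A` is `Λ X : K. A`;
index `0` is the bound variable in `B`, respectively in the body of `lam`. -/
inductive Ty : Type
  | var : ℕ → Ty
  | top : Ty
  | arrow : Ty → Ty → Ty
  | all : Knd → Ty → Ty → Ty
  | lam : Knd → Ty → Ty
  | app : Ty → Ty → Ty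
  deriving DecidableEq

/-! ### Substitution -/

/-- Extension of a renaming under a binder. -/
def upRen (f : ℕ → ℕ) : ℕ → ℕ
  | 0 => 0
  | n + 1 => f n + 1

namespace Ty

/-- Simultaneous renaming of the free variables. -/
def rename : (ℕ → ℕ) → Ty → Ty
  | f, var n => var (f n)
  | _, top => top
  | f, arrow A B => arrow (rename f A) (rename f B)
  | f, all K A B => all K (rename f A) (rename (upRen f) B)
  | f, lam K A => lam K (rename (upRen f) A)
  | f, app A B => app (rename f A) (rename f B)

/-- Weakening of a type by one fresh variable. -/
def shift (A : Ty) : Ty := rename Nat.succ A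

/-- Extension of a substitution under a binder. -/
def upSubst (σ : ℕ → Ty) : ℕ → Ty
  | 0 => var 0
  | n + 1 => (σ n).shift

/-- Capture-avoiding simultaneous substitution. -/
def subst : (ℕ → Ty) → Ty → Ty
  | σ, var n => σ n
  | _, top => top
  | σ, arrow A B => arrow (subst σ A) (subst σ B)
  | σ, all K A B => all K (subst σ A) (subst (upSubst σ) B)
  | σ, lam K A => lam K (subst (upSubst σ) A)
  | σ, app A B => app (subst σ A) (subst σ B)

/-- The substitution replacing variable `0` by `B` and lowering the other variables by one. -/
def single (B : Ty) : ℕ → Ty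
  | 0 => B
  | n + 1 => var n

/-- `A[B/X]`, where `X` is variable `0` of `A`. -/
def inst (A B : Ty) : Ty := subst (single B) A

/-- The top type `T_K` of kind `K`: `T_⋆` is primitive and `T_{K → K'} = Λ X : K. T_{K'}`. -/
def topOf : Knd → Ty
  | .star => top
  | .arr K K' => lam K (topOf K')

end Ty

/-! ### `β`-reduction -/

/-- One-step `β`-reduction `A ▷ B`, in any position. -/
inductive Beta : Ty → Ty → Prop
  | beta (K : Knd) (A B : Ty) : Beta (.app (.lam K A) B) (A.inst B)
  | arrowL {A A' : Ty} (B : Ty) : Beta A A' → Beta (.arrow A B) (.arrow A' B)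
  | arrowR (A : Ty) {B B' : Ty} : Beta B B' → Beta (.arrow A B) (.arrow A B')
  | allL (K : Knd) {A A' : Ty} (B : Ty) : Beta A A' → Beta (.all K A B) (.all K A' B)
  | allR (K : Knd) (A : Ty) {B B' : Ty} : Beta B B' → Beta (.all K A B) (.all K A B')
  | lam (K : Knd) {A A' : Ty} : Beta A A' → Beta (.lam K A) (.lam K A')
  | appL {A A' : Ty} (B : Ty) : Beta A A' → Beta (.app A B) (.app A' B)
  | appR (A : Ty) {B B' : Ty} : Beta B B' → Beta (.app A B) (.app A B')

/-- `β`-equality: the least equivalence relation containing `Beta`. -/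
def BetaEq : Ty → Ty → Prop := Relation.EqvGen Beta

/-- Strong normalization, the inductive predicate: `SN A` iff `SN B` for all `B` with `A ▷ B`. -/
inductive SN : Ty → Prop
  | intro {A : Ty} : (∀ B : Ty, Beta A B → SN B) → SN A

/-! ### Contexts and judgements -/

/-- Contexts, most recent declaration first. The entry `(A, K)` in `(A, K) :: Γ` declares a variable
`X ≤ A : K`, with `A` a type over `Γ`. -/
abbrev Ctx : Type := List (Ty × Knd)

/-- `Lookup Γ n A K`: the variable `n` is declared with bound `A` and kind `K` in `Γ`, where `A` is
weakened to a type over the whole of `Γ`. -/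
inductive Lookup : Ctx → ℕ → Ty → Knd → Prop
  | here (Γ : Ctx) (A : Ty) (K : Knd) : Lookup ((A, K) :: Γ) 0 A.shift K
  | there {Γ : Ctx} {n : ℕ} {A : Ty} {K : Knd} (d : Ty × Knd) :
      Lookup Γ n A K → Lookup (d :: Γ) (n + 1) A.shift K

/-- Kinding `Γ ⊢ A : K`. Well-formedness of `Γ` is the judgement `Γ ⊢ T_⋆ : ⋆`. -/
inductive HasKind : Ctx → Ty → Knd → Prop
  | topEmp : HasKind [] .top .star
  | topExt {Γ : Ctx} {A : Ty} {K : Knd} :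
      HasKind Γ A K → HasKind ((A, K) :: Γ) .top .star
  | var {Γ : Ctx} {n : ℕ} {A : Ty} {K : Knd} :
      HasKind Γ .top .star → Lookup Γ n A K → HasKind Γ (.var n) K
  | lam {Γ : Ctx} {A : Ty} {K K' : Knd} :
      HasKind ((Ty.topOf K, K) :: Γ) A K' → HasKind Γ (.lam K A) (.arr K K')
  | app {Γ : Ctx} {A B : Ty} {K K' : Knd} :
      HasKind Γ A (.arr K K') → HasKind Γ B K → HasKind Γ (.app A B) K'
  | arrow {Γ : Ctx} {A B : Ty} :
      HasKind Γ A .star → HasKind Γ B .star → HasKind Γ (.arrow A B) .star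
  | all {Γ : Ctx} {A B : Ty} {K : Knd} :
      HasKind ((A, K) :: Γ) B .star → HasKind Γ (.all K A B) .star

/-- Subtyping `Γ ⊢ A ≤ B` (the Kernel variant: quantifiers are compared under a common bound, up to
`β`-equality by `conv` and `trans`). -/
inductive Sub : Ctx → Ty → Ty → Prop
  | conv {Γ : Ctx} {A B : Ty} {K : Knd} :
      HasKind Γ A K → HasKind Γ B K → BetaEq A B → Sub Γ A B
  | trans {Γ : Ctx} {A B C : Ty} : Sub Γ A B → Sub Γ B C → Sub Γ A C
  | top {Γ : Ctx} {A : Ty} {K : Knd} : HasKind Γ A K → Sub Γ A (Ty.topOf K)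
  | var {Γ : Ctx} {n : ℕ} {A : Ty} {K : Knd} :
      HasKind Γ .top .star → Lookup Γ n A K → Sub Γ (.var n) A
  | lam {Γ : Ctx} {A B : Ty} {K : Knd} :
      Sub ((Ty.topOf K, K) :: Γ) A B → Sub Γ (.lam K A) (.lam K B)
  | app {Γ : Ctx} {A B C : Ty} {K : Knd} :
      Sub Γ A B → HasKind Γ (.app A C) K → Sub Γ (.app A C) (.app B C)
  | arrow {Γ : Ctx} {A₁ A₂ B₁ B₂ : Ty} :
      Sub Γ B₁ A₁ → Sub Γ A₂ B₂ → HasKind Γ (.arrow A₁ A₂) .star →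
      Sub Γ (.arrow A₁ A₂) (.arrow B₁ B₂)
  | all {Γ : Ctx} {A B D : Ty} {K : Knd} :
      Sub ((A, K) :: Γ) B D → HasKind Γ (.all K A B) .star →
      Sub Γ (.all K A B) (.all K A D)

/-- Kinded subtyping `Γ ⊢ A ≤ B : K`: `A` is a subtype of `B`, and both have kind `K`. -/
def SubAt (Γ : Ctx) (A B : Ty) (K : Knd) : Prop :=
  Sub Γ A B ∧ HasKind Γ A K ∧ HasKind Γ B K

/-! ### Gödel numbering

The bijective numberings through which `ComputablePred` speaks about kinds, types and contexts. -/

namespace Knd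

/-- Gödel number of a kind. -/
def toNat : Knd → ℕ
  | star => 0
  | arr K K' => Nat.pair K.toNat K'.toNat + 1

/-- The kind with a given Gödel number. -/
def ofNat : ℕ → Knd
  | 0 => star
  | n + 1 =>
    have _h1 : n.unpair.1 < n + 1 := Nat.lt_succ_of_le n.unpair_left_le
    have _h2 : n.unpair.2 < n + 1 := Nat.lt_succ_of_le n.unpair_right_le
    arr (ofNat n.unpair.1) (ofNat n.unpair.2)

theorem ofNat_toNat (K : Knd) : ofNat K.toNat = K := by
  induction K with
  | star => simp [toNat, ofNat]
  | arr K K' h h' => simp [toNat, ofNat, h, h']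

theorem toNat_ofNat (n : ℕ) : (ofNat n).toNat = n := by
  induction n using Nat.strong_induction_on with
  | _ n ih =>
    cases n with
    | zero => simp [toNat, ofNat]
    | succ n =>
      rw [ofNat, toNat, ih _ (Nat.lt_succ_of_le n.unpair_left_le),
        ih _ (Nat.lt_succ_of_le n.unpair_right_le), Nat.pair_unpair]

instance : Denumerable Knd := Denumerable.mk' ⟨toNat, ofNat, ofNat_toNat, toNat_ofNat⟩

end Knd

namespace Ty

/-- Gödel number of a type. -/
def toNat : Ty → ℕ
  | top => 0
  | var n => 5 * n + 1
  | arrow A B => 5 * Nat.pair A.toNat B.toNat + 2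
  | app A B => 5 * Nat.pair A.toNat B.toNat + 3
  | lam K A => 5 * Nat.pair K.toNat A.toNat + 4
  | all K A B => 5 * Nat.pair K.toNat (Nat.pair A.toNat B.toNat) + 5

/-- The type with a given Gödel number. -/
def ofNat : ℕ → Ty
  | 0 => top
  | n + 1 =>
    have _h1 : (n / 5).unpair.1 < n + 1 :=
      Nat.lt_succ_of_le ((Nat.unpair_left_le _).trans (Nat.div_le_self n 5))
    have h2 : (n / 5).unpair.2 < n + 1 :=
      Nat.lt_succ_of_le ((Nat.unpair_right_le _).trans (Nat.div_le_self n 5))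
    have _h21 : (n / 5).unpair.2.unpair.1 < n + 1 := (Nat.unpair_left_le _).trans_lt h2
    have _h22 : (n / 5).unpair.2.unpair.2 < n + 1 := (Nat.unpair_right_le _).trans_lt h2
    match n % 5 with
    | 0 => var (n / 5)
    | 1 => arrow (ofNat (n / 5).unpair.1) (ofNat (n / 5).unpair.2)
    | 2 => app (ofNat (n / 5).unpair.1) (ofNat (n / 5).unpair.2)
    | 3 => lam (Knd.ofNat (n / 5).unpair.1) (ofNat (n / 5).unpair.2)
    | _ => all (Knd.ofNat (n / 5).unpair.1) (ofNat (n / 5).unpair.2.unpair.1)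
        (ofNat (n / 5).unpair.2.unpair.2)

theorem ofNat_toNat (A : Ty) : ofNat A.toNat = A := by
  have hd (m r : ℕ) (hr : r < 5) : (5 * m + r) / 5 = m := by omega
  have hm (m r : ℕ) (hr : r < 5) : (5 * m + r) % 5 = r := by omega
  induction A with
  | top => simp [toNat, ofNat]
  | var n => simp [toNat, ofNat]
  | arrow A B hA hB => simp [toNat, ofNat, hd, hm, hA, hB]
  | app A B hA hB => simp [toNat, ofNat, hd, hm, hA, hB]
  | lam K A hA => simp [toNat, ofNat, hd, hm, hA, Knd.ofNat_toNat]
  | all K A B hA hB => simp [toNat, ofNat, hd, hm, hA, hB, Knd.ofNat_toNat]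

theorem toNat_ofNat (n : ℕ) : (ofNat n).toNat = n := by
  induction n using Nat.strong_induction_on with
  | _ n ih =>
    cases n with
    | zero => simp [toNat, ofNat]
    | succ n =>
      have h1 : (n / 5).unpair.1 < n + 1 :=
        Nat.lt_succ_of_le ((Nat.unpair_left_le _).trans (Nat.div_le_self n 5))
      have h2 : (n / 5).unpair.2 < n + 1 :=
        Nat.lt_succ_of_le ((Nat.unpair_right_le _).trans (Nat.div_le_self n 5))
      have i1 := ih _ h1
      have i2 := ih _ h2
      have i21 := ih _ ((Nat.unpair_left_le _).trans_lt h2)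
      have i22 := ih _ ((Nat.unpair_right_le _).trans_lt h2)
      have hn := Nat.div_add_mod n 5
      have hl := Nat.mod_lt n (show 5 > 0 by omega)
      rw [ofNat]
      rcases hr : n % 5 with _ | _ | _ | _ | r <;>
        simp only [toNat, i1, i2, i21, i22, Knd.toNat_ofNat, Nat.pair_unpair] <;> omega

instance : Denumerable Ty := Denumerable.mk' ⟨toNat, ofNat, ofNat_toNat, toNat_ofNat⟩

end Ty

end FOmegaSub

/-! Strong normalization, termination of the subtyping algorithm and antisymmetry all rest on one
interpretation of types, `unfold`, which turns `∀ X ≤ A : K. B` into `A → B[A/X]` and so trades a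
bounded variable for its bound.

A β-step on types becomes one or more β-steps on their images (`Beta.unfold`), and the images of
kinded types are reducible in Tait's sense (`Kinded.reducible`). Hence kinded types are strongly
normalizing. Kinding itself splits into well-formedness of the context and a syntax-directed
relation that sees only kinds (`hasKind_iff`), and is therefore decidable.

For subtyping, transitivity is eliminated. `AlgSub` reduces both sides, then replaces a head
variable by its bound or compares components. It respects β-equality by confluence and is transitive
(`AlgSub.trans_aux`); in the Kernel variant quantified bodies are compared under one common bound,
so no narrowing is needed. On kinded types it agrees with `Sub` (`AlgSub.sub`, `Sub.algSub`).

The algorithm terminates (`acc_smaller`) because promotion leaves the unfolded type unchanged and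
moves the head variable to an earlier declaration, whereas every other move makes the unfolded type
smaller for `Descend`, which is well-founded on strongly normalizing types. Antisymmetry follows
from the same order: if `A ≤ B` used a promotion and `B ≤ A` held, some normal form would be
strictly smaller than itself. The remaining rules decompose both derivations in parallel.

For decidability, one step of the algorithm is a primitive recursive function on stacks of problems.
A search over the number of steps is partial recursive, and termination makes it total. -/

namespace FOmegaSub

/-! ### Algebra of renaming and substitution. -/

namespace Ty

theorem upRen_comp (f g : ℕ → ℕ) : upRen g ∘ upRen f = upRen (g ∘ f) := by
  funext n; cases n <;> rfl

theorem rename_rename (A : Ty) (f g : ℕ → ℕ) : rename g (rename f A) = rename (g ∘ f) A := by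
  induction A generalizing f g with
  | var n => rfl
  | top => rfl
  | arrow A B hA hB => simp [rename, hA, hB]
  | all K A B hA hB => simp [rename, hA, hB, upRen_comp]
  | lam K A hA => simp [rename, hA, upRen_comp]
  | app A B hA hB => simp [rename, hA, hB]

theorem upSubst_comp_upRen (σ : ℕ → Ty) (f : ℕ → ℕ) :
    upSubst σ ∘ upRen f = upSubst (σ ∘ f) := by
  funext n; cases n <;> rfl

theorem subst_rename (A : Ty) (f : ℕ → ℕ) (σ : ℕ → Ty) :
    subst σ (rename f A) = subst (σ ∘ f) A := by
  induction A generalizing f σ with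
  | var n => rfl
  | top => rfl
  | arrow A B hA hB => simp [rename, subst, hA, hB]
  | all K A B hA hB => simp [rename, subst, hA, hB, upSubst_comp_upRen]
  | lam K A hA => simp [rename, subst, hA, upSubst_comp_upRen]
  | app A B hA hB => simp [rename, subst, hA, hB]

theorem rename_shift (A : Ty) (f : ℕ → ℕ) : rename (upRen f) A.shift = (rename f A).shift := by
  simp only [shift, rename_rename]; rfl

theorem rename_comp_upSubst (σ : ℕ → Ty) (f : ℕ → ℕ) :
    rename (upRen f) ∘ upSubst σ = upSubst (rename f ∘ σ) := by
  funext n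
  cases n with
  | zero => rfl
  | succ n => exact rename_shift _ _

theorem rename_subst (A : Ty) (σ : ℕ → Ty) (f : ℕ → ℕ) :
    rename f (subst σ A) = subst (rename f ∘ σ) A := by
  induction A generalizing f σ with
  | var n => rfl
  | top => rfl
  | arrow A B hA hB => simp [rename, subst, hA, hB]
  | all K A B hA hB => simp [rename, subst, hA, hB, rename_comp_upSubst]
  | lam K A hA => simp [rename, subst, hA, rename_comp_upSubst]
  | app A B hA hB => simp [rename, subst, hA, hB]

theorem subst_shift (A : Ty) (σ : ℕ → Ty) : subst (upSubst σ) A.shift = (subst σ A).shift := by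
  simp only [shift, subst_rename, rename_subst]; rfl

theorem subst_comp_upSubst (σ τ : ℕ → Ty) :
    subst (upSubst τ) ∘ upSubst σ = upSubst (subst τ ∘ σ) := by
  funext n
  cases n with
  | zero => rfl
  | succ n => exact subst_shift _ _

theorem subst_subst (A : Ty) (σ τ : ℕ → Ty) :
    subst τ (subst σ A) = subst (subst τ ∘ σ) A := by
  induction A generalizing σ τ with
  | var n => rfl
  | top => rfl
  | arrow A B hA hB => simp [subst, hA, hB]
  | all K A B hA hB => simp [subst, hA, hB, subst_comp_upSubst]
  | lam K A hA => simp [subst, hA, subst_comp_upSubst]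
  | app A B hA hB => simp [subst, hA, hB]

theorem upSubst_var : upSubst var = var := by
  funext n; cases n <;> rfl

theorem subst_var (A : Ty) : subst var A = A := by
  induction A with
  | var n => rfl
  | top => rfl
  | arrow A B hA hB => simp [subst, hA, hB]
  | all K A B hA hB => simp [subst, hA, hB, upSubst_var]
  | lam K A hA => simp [subst, hA, upSubst_var]
  | app A B hA hB => simp [subst, hA, hB]

/-- Extension of a substitution by a value for variable `0`. -/
def scons (B : Ty) (σ : ℕ → Ty) : ℕ → Ty
  | 0 => B
  | n + 1 => σ n

theorem inst_shift (A B : Ty) : A.shift.inst B = A := by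
  rw [inst, shift, subst_rename]; exact subst_var A

theorem subst_comp_single (σ : ℕ → Ty) (B : Ty) :
    subst σ ∘ single B = scons (subst σ B) σ := by
  funext n; cases n <;> rfl

theorem subst_single_comp_upSubst (σ : ℕ → Ty) (B : Ty) :
    subst (single B) ∘ upSubst σ = scons B σ := by
  funext n
  cases n with
  | zero => rfl
  | succ n => exact inst_shift _ _

theorem subst_inst (A B : Ty) (σ : ℕ → Ty) :
    subst σ (A.inst B) = (subst (upSubst σ) A).inst (subst σ B) := by
  simp only [inst, subst_subst, subst_comp_single, subst_single_comp_upSubst]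

theorem rename_eq_subst (A : Ty) (f : ℕ → ℕ) : rename f A = subst (var ∘ f) A := by
  conv_lhs => rw [← subst_var (rename f A), subst_rename]

theorem rename_inst (A B : Ty) (f : ℕ → ℕ) :
    rename f (A.inst B) = (rename (upRen f) A).inst (rename f B) := by
  simp only [inst, rename_subst, subst_rename]
  congr 1; funext n; cases n <;> rfl

theorem subst_topOf (K : Knd) (σ : ℕ → Ty) : subst σ (topOf K) = topOf K := by
  induction K generalizing σ with
  | star => rfl
  | arr K K' _ h => simp [topOf, subst, h]

theorem rename_topOf (K : Knd) (f : ℕ → ℕ) : rename f (topOf K) = topOf K := by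
  rw [rename_eq_subst, subst_topOf]

theorem shift_topOf (K : Knd) : (topOf K).shift = topOf K := rename_topOf K _

end Ty

/-- Many-step `β`-reduction. -/
abbrev Reds : Ty → Ty → Prop := Relation.ReflTransGen Beta

/-- Normal forms of `β`-reduction. -/
def Normal (A : Ty) : Prop := ∀ B, ¬ Beta A B

/-! ### Reduction under substitution; congruence and inversion of many-step reduction. -/

theorem Beta.subst {A B : Ty} (h : Beta A B) (σ : ℕ → Ty) : Beta (A.subst σ) (B.subst σ) := by
  induction h generalizing σ with
  | beta K A B => rw [Ty.subst_inst]; exact .beta K _ _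
  | arrowL B _ ih => exact .arrowL _ (ih σ)
  | arrowR A _ ih => exact .arrowR _ (ih σ)
  | allL K B _ ih => exact .allL K _ (ih σ)
  | allR K A _ ih => exact .allR K _ (ih _)
  | lam K _ ih => exact .lam K (ih _)
  | appL B _ ih => exact .appL _ (ih σ)
  | appR A _ ih => exact .appR _ (ih σ)

theorem Beta.rename {A B : Ty} (h : Beta A B) (f : ℕ → ℕ) : Beta (A.rename f) (B.rename f) := by
  rw [Ty.rename_eq_subst, Ty.rename_eq_subst]; exact h.subst _

namespace Reds

theorem lift (f : Ty → Ty) (hf : ∀ {A B}, Beta A B → Beta (f A) (f B)) {A B : Ty}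
    (h : Reds A B) : Reds (f A) (f B) := by
  induction h with
  | refl => exact .refl
  | tail _ h ih => exact ih.tail (hf h)

theorem subst {A B : Ty} (h : Reds A B) (σ : ℕ → Ty) : Reds (A.subst σ) (B.subst σ) :=
  lift (Ty.subst σ) (fun h => h.subst σ) h

theorem rename {A B : Ty} (h : Reds A B) (f : ℕ → ℕ) : Reds (A.rename f) (B.rename f) :=
  lift (Ty.rename f) (fun h => h.rename f) h

theorem arrow {A A' B B' : Ty} (h : Reds A A') (h' : Reds B B') :
    Reds (.arrow A B) (.arrow A' B') :=
  (lift (Ty.arrow · B) (fun h => .arrowL B h) h).trans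
    (lift (Ty.arrow A') (fun h => .arrowR A' h) h')

theorem app {A A' B B' : Ty} (h : Reds A A') (h' : Reds B B') :
    Reds (.app A B) (.app A' B') :=
  (lift (Ty.app · B) (fun h => .appL B h) h).trans
    (lift (Ty.app A') (fun h => .appR A' h) h')

theorem all (K : Knd) {A A' B B' : Ty} (h : Reds A A') (h' : Reds B B') :
    Reds (.all K A B) (.all K A' B') :=
  (lift (Ty.all K · B) (fun h => .allL K B h) h).trans
    (lift (Ty.all K A') (fun h => .allR K A' h) h')

theorem lam (K : Knd) {A A' : Ty} (h : Reds A A') : Reds (.lam K A) (.lam K A') :=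
  lift (Ty.lam K) (fun h => .lam K h) h

theorem betaEq {A B : Ty} (h : Reds A B) : BetaEq A B := by
  induction h with
  | refl => exact .refl _
  | tail _ h ih => exact ih.trans _ _ _ (.rel _ _ h)

theorem arrow_inv {A B C : Ty} (h : Reds (.arrow A B) C) :
    ∃ A' B', C = .arrow A' B' ∧ Reds A A' ∧ Reds B B' := by
  induction h with
  | refl => exact ⟨A, B, rfl, .refl, .refl⟩
  | tail _ h ih =>
    obtain ⟨A', B', rfl, hA, hB⟩ := ih
    cases h with
    | arrowL _ h => exact ⟨_, _, rfl, hA.tail h, hB⟩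
    | arrowR _ h => exact ⟨_, _, rfl, hA, hB.tail h⟩

theorem all_inv {K : Knd} {A B C : Ty} (h : Reds (.all K A B) C) :
    ∃ A' B', C = .all K A' B' ∧ Reds A A' ∧ Reds B B' := by
  induction h with
  | refl => exact ⟨A, B, rfl, .refl, .refl⟩
  | tail _ h ih =>
    obtain ⟨A', B', rfl, hA, hB⟩ := ih
    cases h with
    | allL _ _ h => exact ⟨_, _, rfl, hA.tail h, hB⟩
    | allR _ _ h => exact ⟨_, _, rfl, hA, hB.tail h⟩

theorem lam_inv {K : Knd} {A C : Ty} (h : Reds (.lam K A) C) :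
    ∃ A', C = .lam K A' ∧ Reds A A' := by
  induction h with
  | refl => exact ⟨A, rfl, .refl⟩
  | tail _ h ih =>
    obtain ⟨A', rfl, hA⟩ := ih
    cases h with
    | lam _ h => exact ⟨_, rfl, hA.tail h⟩

end Reds

theorem Normal.eq_of_reds {A B : Ty} (hA : Normal A) (h : Reds A B) : B = A := by
  induction h with
  | refl => rfl
  | tail _ h ih => subst ih; exact absurd h (hA _)

theorem normal_topOf (K : Knd) : Normal (Ty.topOf K) := by
  induction K with
  | star => intro B h; cases h
  | arr K K' _ ih =>
    intro B h
    cases h with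
    | lam _ h => exact ih _ h

/-! ### Confluence -/

/-- Parallel `β`-reduction. -/
inductive Par : Ty → Ty → Prop
  | var (n : ℕ) : Par (.var n) (.var n)
  | top : Par .top .top
  | arrow {A A' B B' : Ty} : Par A A' → Par B B' → Par (.arrow A B) (.arrow A' B')
  | all (K : Knd) {A A' B B' : Ty} : Par A A' → Par B B' → Par (.all K A B) (.all K A' B')
  | lam (K : Knd) {A A' : Ty} : Par A A' → Par (.lam K A) (.lam K A')
  | app {A A' B B' : Ty} : Par A A' → Par B B' → Par (.app A B) (.app A' B')
  | beta (K : Knd) {A A' B B' : Ty} : Par A A' → Par B B' → Par (.app (.lam K A) B) (A'.inst B')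

theorem Par.refl (A : Ty) : Par A A := by
  induction A with
  | var n => exact .var n
  | top => exact .top
  | arrow A B hA hB => exact .arrow hA hB
  | all K A B hA hB => exact .all K hA hB
  | lam K A hA => exact .lam K hA
  | app A B hA hB => exact .app hA hB

theorem Beta.par {A B : Ty} (h : Beta A B) : Par A B := by
  induction h with
  | beta K A B => exact .beta K (.refl _) (.refl _)
  | arrowL B _ ih => exact .arrow ih (.refl _)
  | arrowR A _ ih => exact .arrow (.refl _) ih
  | allL K B _ ih => exact .all K ih (.refl _)
  | allR K A _ ih => exact .all K (.refl _) ih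
  | lam K _ ih => exact .lam K ih
  | appL B _ ih => exact .app ih (.refl _)
  | appR A _ ih => exact .app (.refl _) ih

theorem Par.reds {A B : Ty} (h : Par A B) : Reds A B := by
  induction h with
  | var n => exact .refl
  | top => exact .refl
  | arrow _ _ hA hB => exact hA.arrow hB
  | all K _ _ hA hB => exact hA.all K hB
  | lam K _ hA => exact hA.lam K
  | app _ _ hA hB => exact hA.app hB
  | beta K _ _ hA hB => exact ((hA.lam K).app hB).tail (.beta K _ _)

theorem Par.rename {A B : Ty} (h : Par A B) (f : ℕ → ℕ) : Par (A.rename f) (B.rename f) := by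
  induction h generalizing f with
  | var n => exact .var _
  | top => exact .top
  | arrow _ _ hA hB => exact .arrow (hA f) (hB f)
  | all K _ _ hA hB => exact .all K (hA f) (hB _)
  | lam K _ hA => exact .lam K (hA _)
  | app _ _ hA hB => exact .app (hA f) (hB f)
  | beta K _ _ hA hB => rw [Ty.rename_inst]; exact .beta K (hA _) (hB f)

theorem Par.upSubst {σ τ : ℕ → Ty} (h : ∀ n, Par (σ n) (τ n)) (n : ℕ) :
    Par (Ty.upSubst σ n) (Ty.upSubst τ n) := by
  cases n with
  | zero => exact .var 0
  | succ n => exact (h n).rename _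

theorem Par.subst {A B : Ty} (h : Par A B) {σ τ : ℕ → Ty} (hσ : ∀ n, Par (σ n) (τ n)) :
    Par (A.subst σ) (B.subst τ) := by
  induction h generalizing σ τ with
  | var n => exact hσ n
  | top => exact .top
  | arrow _ _ hA hB => exact .arrow (hA hσ) (hB hσ)
  | all K _ _ hA hB => exact .all K (hA hσ) (hB (Par.upSubst hσ))
  | lam K _ hA => exact .lam K (hA (Par.upSubst hσ))
  | app _ _ hA hB => exact .app (hA hσ) (hB hσ)
  | beta K _ _ hA hB => rw [Ty.subst_inst]; exact .beta K (hA (Par.upSubst hσ)) (hB hσ)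

theorem Par.inst {A A' B B' : Ty} (h : Par A A') (h' : Par B B') :
    Par (A.inst B) (A'.inst B') := by
  refine h.subst fun n => ?_
  cases n with
  | zero => exact h'
  | succ n => exact .var n

/-- Two different rules can apply only to an application of an abstraction. There the parallel
reduct of the abstraction is again an abstraction, so the contraction is still possible on that side
and `Par.inst` closes the square. -/
theorem Par.diamond {A B C : Ty} (hB : Par A B) (hC : Par A C) : ∃ D, Par B D ∧ Par C D := by
  induction hB generalizing C with
  | var n => exact ⟨C, hC, .refl C⟩
  | top => exact ⟨C, hC, .refl C⟩
  | arrow _ _ ih₁ ih₂ =>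
    cases hC with
    | arrow h₁ h₂ =>
      obtain ⟨D₁, a₁, b₁⟩ := ih₁ h₁
      obtain ⟨D₂, a₂, b₂⟩ := ih₂ h₂
      exact ⟨_, .arrow a₁ a₂, .arrow b₁ b₂⟩
  | all K _ _ ih₁ ih₂ =>
    cases hC with
    | all _ h₁ h₂ =>
      obtain ⟨D₁, a₁, b₁⟩ := ih₁ h₁
      obtain ⟨D₂, a₂, b₂⟩ := ih₂ h₂
      exact ⟨_, .all K a₁ a₂, .all K b₁ b₂⟩
  | lam K _ ih =>
    cases hC with
    | lam _ h =>
      obtain ⟨D, a, b⟩ := ih h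
      exact ⟨_, .lam K a, .lam K b⟩
  | app p _ ih₁ ih₂ =>
    cases hC with
    | app h₁ h₂ =>
      obtain ⟨D₁, a₁, b₁⟩ := ih₁ h₁
      obtain ⟨D₂, a₂, b₂⟩ := ih₂ h₂
      exact ⟨_, .app a₁ a₂, .app b₁ b₂⟩
    | beta K h₁ h₂ =>
      obtain ⟨D₁, a₁, b₁⟩ := ih₁ (.lam K h₁)
      obtain ⟨D₂, a₂, b₂⟩ := ih₂ h₂
      cases p with
      | lam _ p =>
        cases b₁ with
        | lam _ b₁ =>
          cases a₁ with
          | lam _ a₁ => exact ⟨_, .beta K a₁ a₂, b₁.inst b₂⟩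
  | beta K _ _ ih₁ ih₂ =>
    cases hC with
    | app h₁ h₂ =>
      cases h₁ with
      | lam _ h₁ =>
        obtain ⟨D₁, a₁, b₁⟩ := ih₁ h₁
        obtain ⟨D₂, a₂, b₂⟩ := ih₂ h₂
        exact ⟨_, a₁.inst a₂, .beta K b₁ b₂⟩
    | beta _ h₁ h₂ =>
      obtain ⟨D₁, a₁, b₁⟩ := ih₁ h₁
      obtain ⟨D₂, a₂, b₂⟩ := ih₂ h₂
      exact ⟨_, a₁.inst a₂, b₁.inst b₂⟩

theorem reds_iff_par {A B : Ty} : Reds A B ↔ Relation.ReflTransGen Par A B := by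
  constructor
  · intro h
    induction h with
    | refl => exact .refl
    | tail _ h ih => exact ih.tail h.par
  · intro h
    induction h with
    | refl => exact .refl
    | tail _ h ih => exact ih.trans h.reds

/-- The method of Tait and Martin-Löf: `Par` lies between `Beta` and `Reds`, so its reflexive
transitive closure is `Reds`, and the diamond property passes to that closure. -/
theorem Reds.confluent {A B C : Ty} (hB : Reds A B) (hC : Reds A C) :
    ∃ D, Reds B D ∧ Reds C D := by
  rw [reds_iff_par] at hB hC
  obtain ⟨D, h, h'⟩ := Relation.church_rosser
    (fun a b c hb hc => by
      obtain ⟨d, h, h'⟩ := Par.diamond hb hc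
      exact ⟨d, .single h, .single h'⟩) hB hC
  exact ⟨D, reds_iff_par.2 h, reds_iff_par.2 h'⟩

/-! ### Church–Rosser property and congruence of β-equality. -/

namespace BetaEq

theorem trans {A B C : Ty} (h : BetaEq A B) (h' : BetaEq B C) : BetaEq A C :=
  Relation.EqvGen.trans _ _ _ h h'

theorem symm {A B : Ty} (h : BetaEq A B) : BetaEq B A := Relation.EqvGen.symm _ _ h

theorem church_rosser {A B : Ty} (h : BetaEq A B) : ∃ C, Reds A C ∧ Reds B C := by
  induction h with
  | rel A B h => exact ⟨B, .single h, .refl⟩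
  | refl A => exact ⟨A, .refl, .refl⟩
  | symm A B _ ih => obtain ⟨C, h, h'⟩ := ih; exact ⟨C, h', h⟩
  | trans A B C _ _ ih₁ ih₂ =>
    obtain ⟨D, a, b⟩ := ih₁
    obtain ⟨E, c, d⟩ := ih₂
    obtain ⟨F, p, q⟩ := b.confluent c
    exact ⟨F, a.trans p, d.trans q⟩

theorem subst {A B : Ty} (h : BetaEq A B) (σ : ℕ → Ty) : BetaEq (A.subst σ) (B.subst σ) := by
  obtain ⟨C, hA, hB⟩ := h.church_rosser
  exact (hA.subst σ).betaEq.trans (hB.subst σ).betaEq.symm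

theorem shift {A B : Ty} (h : BetaEq A B) : BetaEq A.shift B.shift := by
  obtain ⟨C, hA, hB⟩ := h.church_rosser
  exact (hA.rename _).betaEq.trans (hB.rename _).betaEq.symm

theorem app {A A' B B' : Ty} (h : BetaEq A A') (h' : BetaEq B B') :
    BetaEq (.app A B) (.app A' B') := by
  obtain ⟨C, hA, hA'⟩ := h.church_rosser
  obtain ⟨D, hB, hB'⟩ := h'.church_rosser
  exact (hA.app hB).betaEq.trans (hA'.app hB').betaEq.symm

theorem lam (K : Knd) {A A' : Ty} (h : BetaEq A A') : BetaEq (.lam K A) (.lam K A') := by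
  obtain ⟨C, hA, hA'⟩ := h.church_rosser
  exact (hA.lam K).betaEq.trans (hA'.lam K).betaEq.symm

theorem arrow {A A' B B' : Ty} (h : BetaEq A A') (h' : BetaEq B B') :
    BetaEq (.arrow A B) (.arrow A' B') := by
  obtain ⟨C, hA, hA'⟩ := h.church_rosser
  obtain ⟨D, hB, hB'⟩ := h'.church_rosser
  exact (hA.arrow hB).betaEq.trans (hA'.arrow hB').betaEq.symm

theorem all (K : Knd) {A A' B B' : Ty} (h : BetaEq A A') (h' : BetaEq B B') :
    BetaEq (.all K A B) (.all K A' B') := by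
  obtain ⟨C, hA, hA'⟩ := h.church_rosser
  obtain ⟨D, hB, hB'⟩ := h'.church_rosser
  exact (hA.all K hB).betaEq.trans (hA'.all K hB').betaEq.symm

theorem reds_of_normal {A B : Ty} (h : BetaEq A B) (hB : Normal B) : Reds A B := by
  obtain ⟨C, hA, hB'⟩ := h.church_rosser
  rwa [hB.eq_of_reds hB'] at hA

end BetaEq

/-! ### Kinding without bounds -/

/-- Kinding in which the context records only the kinds of the variables. -/
inductive Kinded : List Knd → Ty → Knd → Prop
  | var {Δ : List Knd} {n : ℕ} {K : Knd} : Δ[n]? = some K → Kinded Δ (.var n) K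
  | top {Δ : List Knd} : Kinded Δ .top .star
  | arrow {Δ : List Knd} {A B : Ty} :
      Kinded Δ A .star → Kinded Δ B .star → Kinded Δ (.arrow A B) .star
  | all {Δ : List Knd} {A B : Ty} {K : Knd} :
      Kinded Δ A K → Kinded (K :: Δ) B .star → Kinded Δ (.all K A B) .star
  | lam {Δ : List Knd} {A : Ty} {K K' : Knd} :
      Kinded (K :: Δ) A K' → Kinded Δ (.lam K A) (.arr K K')
  | app {Δ : List Knd} {A B : Ty} {K K' : Knd} :
      Kinded Δ A (.arr K K') → Kinded Δ B K → Kinded Δ (.app A B) K'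

/-- Well-formed contexts: every bound has its declared kind. -/
def WellFormed : Ctx → Prop
  | [] => True
  | (A, K) :: Γ => WellFormed Γ ∧ Kinded (Γ.map Prod.snd) A K

namespace Kinded

theorem unique {Δ : List Knd} {A : Ty} {K K' : Knd} (h : Kinded Δ A K) (h' : Kinded Δ A K') :
    K = K' := by
  induction h generalizing K' with
  | var h => cases h' with | var h' => exact Option.some.inj (h.symm.trans h')
  | top => cases h'; rfl
  | arrow => cases h'; rfl
  | all => cases h'; rfl
  | lam _ ih => cases h' with | lam h' => rw [ih h']
  | app _ _ ih _ => cases h' with | app h' _ => exact (Knd.arr.inj (ih h')).2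

theorem rename {Δ Δ' : List Knd} {A : Ty} {K : Knd} {f : ℕ → ℕ} (h : Kinded Δ A K)
    (hf : ∀ n K, Δ[n]? = some K → Δ'[f n]? = some K) : Kinded Δ' (A.rename f) K := by
  have up {Δ Δ' : List Knd} {f : ℕ → ℕ} (K₀ : Knd)
      (hf : ∀ n K, Δ[n]? = some K → Δ'[f n]? = some K) (n : ℕ) (K : Knd)
      (h : (K₀ :: Δ)[n]? = some K) : (K₀ :: Δ')[upRen f n]? = some K := by
    cases n with
    | zero => exact h
    | succ n => exact hf n K h
  induction h generalizing Δ' f with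
  | var h => exact .var (hf _ _ h)
  | top => exact .top
  | arrow _ _ hA hB => exact .arrow (hA hf) (hB hf)
  | all _ _ hA hB => exact .all (hA hf) (hB (up _ hf))
  | lam _ hA => exact .lam (hA (up _ hf))
  | app _ _ hA hB => exact .app (hA hf) (hB hf)

theorem shift {Δ : List Knd} {A : Ty} {K : Knd} (h : Kinded Δ A K) (K' : Knd) :
    Kinded (K' :: Δ) A.shift K :=
  h.rename fun _ _ h => h

theorem subst {Δ Δ' : List Knd} {A : Ty} {K : Knd} {σ : ℕ → Ty} (h : Kinded Δ A K)
    (hσ : ∀ n K, Δ[n]? = some K → Kinded Δ' (σ n) K) : Kinded Δ' (A.subst σ) K := by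
  have up {Δ Δ' : List Knd} {σ : ℕ → Ty} (K₀ : Knd)
      (hσ : ∀ n K, Δ[n]? = some K → Kinded Δ' (σ n) K) (n : ℕ) (K : Knd)
      (h : (K₀ :: Δ)[n]? = some K) : Kinded (K₀ :: Δ') (Ty.upSubst σ n) K := by
    cases n with
    | zero => exact .var h
    | succ n => exact (hσ n K h).shift _
  induction h generalizing Δ' σ with
  | var h => exact hσ _ _ h
  | top => exact .top
  | arrow _ _ hA hB => exact .arrow (hA hσ) (hB hσ)
  | all _ _ hA hB => exact .all (hA hσ) (hB (up _ hσ))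
  | lam _ hA => exact .lam (hA (up _ hσ))
  | app _ _ hA hB => exact .app (hA hσ) (hB hσ)

theorem inst {Δ : List Knd} {A B : Ty} {K K' : Knd} (h : Kinded (K :: Δ) A K')
    (hB : Kinded Δ B K) : Kinded Δ (A.inst B) K' := by
  refine h.subst fun n K₀ hn => ?_
  cases n with
  | zero => obtain rfl : K = K₀ := by simpa using hn
            exact hB
  | succ n => exact .var hn

theorem topOf (Δ : List Knd) (K : Knd) : Kinded Δ (Ty.topOf K) K := by
  induction K generalizing Δ with
  | star => exact .top
  | arr K K' _ ih => exact .lam (ih _)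

theorem beta {Δ : List Knd} {A B : Ty} {K : Knd} (h : Kinded Δ A K) (hAB : Beta A B) :
    Kinded Δ B K := by
  induction hAB generalizing Δ K with
  | beta K₀ A B => cases h with | app h hB => cases h with | lam h => exact h.inst hB
  | arrowL B _ ih => cases h with | arrow h h' => exact .arrow (ih h) h'
  | arrowR A _ ih => cases h with | arrow h h' => exact .arrow h (ih h')
  | allL K B _ ih => cases h with | all h h' => exact .all (ih h) h'
  | allR K A _ ih => cases h with | all h h' => exact .all h (ih h')
  | lam K _ ih => cases h with | lam h => exact .lam (ih h)
  | appL B _ ih => cases h with | app h h' => exact .app (ih h) h'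
  | appR A _ ih => cases h with | app h h' => exact .app h (ih h')

theorem reds {Δ : List Knd} {A B : Ty} {K : Knd} (h : Kinded Δ A K) (hAB : Reds A B) :
    Kinded Δ B K := by
  induction hAB with
  | refl => exact h
  | tail _ hb ih => exact ih.beta hb

end Kinded

theorem Lookup.getElem? {Γ : Ctx} {n : ℕ} {A : Ty} {K : Knd} (h : Lookup Γ n A K) :
    (Γ.map Prod.snd)[n]? = some K := by
  induction h with
  | here Γ A K => rfl
  | there d _ ih => exact ih

theorem exists_lookup {Γ : Ctx} {n : ℕ} {K : Knd} (h : (Γ.map Prod.snd)[n]? = some K) :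
    ∃ A, Lookup Γ n A K := by
  induction Γ generalizing n with
  | nil => simp at h
  | cons d Γ ih =>
    obtain ⟨A, K₀⟩ := d
    cases n with
    | zero =>
      obtain rfl : K₀ = K := by simpa using h
      exact ⟨_, .here Γ A K₀⟩
    | succ n =>
      obtain ⟨B, hB⟩ := ih (n := n) h
      exact ⟨_, .there _ hB⟩

theorem Lookup.kinded {Γ : Ctx} {n : ℕ} {A : Ty} {K : Knd} (h : Lookup Γ n A K)
    (hΓ : WellFormed Γ) : Kinded (Γ.map Prod.snd) A K := by
  induction h with
  | here Γ A K => exact hΓ.2.shift _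
  | there d _ ih => exact (ih hΓ.1).shift _

theorem HasKind.topOf {Γ : Ctx} (h : HasKind Γ .top .star) (K : Knd) :
    HasKind Γ (Ty.topOf K) K := by
  induction K generalizing Γ with
  | star => exact h
  | arr K K' ih ih' => exact .lam (ih' (.topExt (ih h)))

theorem Kinded.hasKind {Γ : Ctx} {A : Ty} {K : Knd} (h : Kinded (Γ.map Prod.snd) A K)
    (hΓ : HasKind Γ .top .star) : HasKind Γ A K := by
  generalize hΔ : Γ.map Prod.snd = Δ at h
  induction h generalizing Γ with
  | var h =>
    subst hΔ
    obtain ⟨B, hB⟩ := exists_lookup h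
    exact .var hΓ hB
  | top => exact hΓ
  | arrow _ _ hA hB => exact .arrow (hA hΓ hΔ) (hB hΓ hΔ)
  | @all _ A _ K _ _ hA hB =>
    exact .all (hB (Γ := (A, K) :: Γ) (.topExt (hA hΓ hΔ)) (by simp [hΔ]))
  | @lam _ _ K _ _ hA =>
    exact .lam (hA (Γ := (Ty.topOf K, K) :: Γ) (.topExt (hΓ.topOf K)) (by simp [hΔ]))
  | app _ _ hA hB => exact .app (hA hΓ hΔ) (hB hΓ hΔ)

/-- A bound matters to kinding only through the check that it has its declared kind. Separating that
check leaves a relation on lists of kinds, where uniqueness of kinds, subject reduction and kind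
inference are plain inductions. -/
theorem hasKind_iff {Γ : Ctx} {A : Ty} {K : Knd} :
    HasKind Γ A K ↔ WellFormed Γ ∧ Kinded (Γ.map Prod.snd) A K := by
  constructor
  · intro h
    induction h with
    | topEmp => exact ⟨trivial, .top⟩
    | topExt _ ih => exact ⟨ih, .top⟩
    | var _ h ih => exact ⟨ih.1, .var h.getElem?⟩
    | lam _ ih => exact ⟨ih.1.1, .lam ih.2⟩
    | app _ _ ih ih' => exact ⟨ih.1, .app ih.2 ih'.2⟩
    | arrow _ _ ih ih' => exact ⟨ih.1, .arrow ih.2 ih'.2⟩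
    | all _ ih => exact ⟨ih.1.1, .all ih.1.2 ih.2⟩
  · rintro ⟨hΓ, h⟩
    refine h.hasKind ?_
    clear h
    induction Γ with
    | nil => exact .topEmp
    | cons d Γ ih => exact .topExt (hΓ.2.hasKind (ih hΓ.1))

/-- The rules kind only some of the types they mention. Uniqueness of kinds matches the kinds
obtained from different premises, for example those of the middle type in transitivity. -/
theorem Sub.kinded {Γ : Ctx} {A B : Ty} (h : Sub Γ A B) :
    WellFormed Γ ∧ ∃ K, Kinded (Γ.map Prod.snd) A K ∧ Kinded (Γ.map Prod.snd) B K := by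
  induction h with
  | conv hA hB _ =>
    rw [hasKind_iff] at hA hB
    exact ⟨hA.1, _, hA.2, hB.2⟩
  | trans _ _ ih ih' =>
    obtain ⟨hΓ, K, hA, hB⟩ := ih
    obtain ⟨_, K', hB', hC⟩ := ih'
    obtain rfl := hB.unique hB'
    exact ⟨hΓ, K, hA, hC⟩
  | top hA =>
    rw [hasKind_iff] at hA
    exact ⟨hA.1, _, hA.2, .topOf _ _⟩
  | var hΓ h =>
    rw [hasKind_iff] at hΓ
    exact ⟨hΓ.1, _, .var h.getElem?, h.kinded hΓ.1⟩
  | lam _ ih =>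
    obtain ⟨hΓ, K, hA, hB⟩ := ih
    exact ⟨hΓ.1, _, .lam hA, .lam hB⟩
  | app _ h ih =>
    obtain ⟨hΓ, K, hA, hB⟩ := ih
    cases (hasKind_iff.1 h).2 with
    | app hA' hC =>
      obtain rfl := hA.unique hA'
      exact ⟨hΓ, _, .app hA' hC, .app hB hC⟩
  | arrow _ _ h ih ih' =>
    obtain ⟨hΓ, K, hB₁, hA₁⟩ := ih
    obtain ⟨_, K', hA₂, hB₂⟩ := ih'
    cases (hasKind_iff.1 h).2 with
    | arrow h₁ h₂ =>
      obtain rfl := hA₁.unique h₁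
      obtain rfl := hA₂.unique h₂
      exact ⟨hΓ, _, .arrow h₁ h₂, .arrow hB₁ hB₂⟩
  | all _ h ih =>
    obtain ⟨hΓ, K, hB, hD⟩ := ih
    cases (hasKind_iff.1 h).2 with
    | all h₁ h₂ =>
      obtain rfl := hB.unique h₂
      exact ⟨hΓ.1, _, .all h₁ h₂, .all h₁ hD⟩

/-! ### Strong normalization -/

namespace SN

theorem beta {A B : Ty} (h : SN A) (hAB : Beta A B) : SN B := by
  cases h with
  | intro h => exact h B hAB

theorem of_lift {A : Ty} (f : Ty → Ty) (hf : ∀ {A B}, Beta A B → Beta (f A) (f B))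
    (h : SN (f A)) : SN A := by
  generalize hB : f A = B at h
  induction h generalizing A with
  | intro _ ih =>
    subst hB
    exact .intro fun B hB => ih _ (hf hB) rfl

theorem arrow {A B : Ty} (hA : SN A) (hB : SN B) : SN (.arrow A B) := by
  induction hA generalizing B with
  | intro _ ihA =>
    induction hB with
    | intro hB ihB =>
      refine .intro fun C hC => ?_
      cases hC with
      | arrowL _ h => exact ihA _ h (.intro hB)
      | arrowR _ h => exact ihB _ h

theorem exists_normal {A : Ty} (h : SN A) : ∃ B, Reds A B ∧ Normal B := by
  induction h with
  | @intro A _ ih =>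
    by_cases hA : Normal A
    · exact ⟨A, .refl, hA⟩
    · obtain ⟨B, hB⟩ := not_forall_not.1 hA
      obtain ⟨C, hC, hn⟩ := ih B hB
      exact ⟨C, .head hB hC, hn⟩

end SN

/-- Reducibility candidates: hereditary strong normalization at a kind. -/
def Reducible : Knd → Ty → Prop
  | .star, A => SN A
  | .arr K K', A => ∀ B, Reducible K B → Reducible K' (.app A B)

/-- Types that are not abstractions: applying them creates no redex. -/
def NonLam (A : Ty) : Prop := ∀ K B, A ≠ .lam K B

namespace Reducible

theorem beta {K : Knd} {A B : Ty} (h : Reducible K A) (hAB : Beta A B) : Reducible K B := by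
  induction K generalizing A B with
  | star => exact SN.beta h hAB
  | arr K K' _ ih => exact fun C hC => ih (h C hC) (.appL C hAB)

/-- The two conditions need each other. At an arrow kind, strong normalization is read off after
application to a variable, which is reducible by the second condition at the domain; the second
condition in turn needs strongly normalizing arguments for its inner induction. -/
theorem sn_and_of_nonLam (K : Knd) : (∀ A, Reducible K A → SN A) ∧
    ∀ A, NonLam A → (∀ B, Beta A B → Reducible K B) → Reducible K A := by
  induction K with
  | star => exact ⟨fun A h => h, fun A _ h => .intro h⟩
  | arr K K' ih ih' =>
    have h0 : Reducible K (.var 0) := ih.2 _ (fun _ _ h => by cases h) fun B h => by cases h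
    refine ⟨fun A h => (ih'.1 _ (h _ h0)).of_lift (Ty.app · (.var 0)) fun h => .appL _ h, ?_⟩
    intro A hA h B hB
    induction ih.1 B hB with
    | @intro B _ ihB =>
      refine ih'.2 _ (fun _ _ h => by cases h) fun C hC => ?_
      cases hC with
      | beta K₀ A₀ _ => exact absurd rfl (hA K₀ A₀)
      | appL _ hA' => exact h _ hA' B hB
      | appR _ hB' => exact ihB _ hB' (hB.beta hB')

theorem sn {K : Knd} {A : Ty} (h : Reducible K A) : SN A := (sn_and_of_nonLam K).1 A h

theorem of_nonLam {K : Knd} {A : Ty} (hA : NonLam A) (h : ∀ B, Beta A B → Reducible K B) :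
    Reducible K A := (sn_and_of_nonLam K).2 A hA h

theorem var (K : Knd) (n : ℕ) : Reducible K (.var n) :=
  of_nonLam (fun _ _ h => by cases h) fun B h => by cases h

theorem lam {K K' : Knd} {A : Ty} (h : ∀ B, Reducible K B → Reducible K' (A.inst B)) :
    Reducible (.arr K K') (.lam K A) := by
  intro B hB
  -- A variable is a reducible argument, and an infinite reduction of the body would survive its
  -- substitution.
  have hA : SN A := (h _ (var K 0)).sn.of_lift (Ty.subst _) fun h => h.subst _
  induction hA generalizing B with
  | @intro A _ ihA =>
    induction hB.sn with
    | @intro B _ ihB =>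
      refine of_nonLam (fun _ _ h => by cases h) fun C hC => ?_
      cases hC with
      | beta => exact h B hB
      | appL _ hA' =>
        cases hA' with
        | lam _ hA' => exact ihA _ hA' (fun D hD => (h D hD).beta (hA'.subst _)) B hB
      | appR _ hB' => exact ihB _ hB' (hB.beta hB')

end Reducible

/-! ### Unfolding of bounds -/

/-- `unfold σ A` substitutes `σ` in `A` and replaces every `∀ X ≤ C. B` by `C → B[C/X]`. -/
def unfold : (ℕ → Ty) → Ty → Ty
  | σ, .var n => σ n
  | _, .top => .top
  | σ, .arrow A B => .arrow (unfold σ A) (unfold σ B)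
  | σ, .all _ A B => .arrow (unfold σ A) (unfold (Ty.scons (unfold σ A) σ) B)
  | σ, .lam K A => .lam K (unfold (Ty.upSubst σ) A)
  | σ, .app A B => .app (unfold σ A) (unfold σ B)

theorem comp_scons (g : Ty → Ty) (A : Ty) (σ : ℕ → Ty) :
    g ∘ Ty.scons A σ = Ty.scons (g A) (g ∘ σ) := by
  funext n; cases n <;> rfl

theorem scons_comp_upRen (A : Ty) (σ : ℕ → Ty) (f : ℕ → ℕ) :
    Ty.scons A σ ∘ upRen f = Ty.scons A (σ ∘ f) := by
  funext n; cases n <;> rfl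

theorem unfold_rename (A : Ty) (f : ℕ → ℕ) (σ : ℕ → Ty) :
    unfold σ (A.rename f) = unfold (σ ∘ f) A := by
  induction A generalizing f σ with
  | var n => rfl
  | top => rfl
  | arrow A B hA hB => simp [Ty.rename, unfold, hA, hB]
  | all K A B hA hB => simp [Ty.rename, unfold, hA, hB, scons_comp_upRen]
  | lam K A hA => simp [Ty.rename, unfold, hA, Ty.upSubst_comp_upRen]
  | app A B hA hB => simp [Ty.rename, unfold, hA, hB]

theorem unfold_scons_shift (A B : Ty) (σ : ℕ → Ty) :
    unfold (Ty.scons B σ) A.shift = unfold σ A :=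
  unfold_rename A _ _

theorem rename_unfold (A : Ty) (σ : ℕ → Ty) (f : ℕ → ℕ) :
    (unfold σ A).rename f = unfold (Ty.rename f ∘ σ) A := by
  induction A generalizing f σ with
  | var n => rfl
  | top => rfl
  | arrow A B hA hB => simp [Ty.rename, unfold, hA, hB]
  | all K A B hA hB => simp [Ty.rename, unfold, hA, hB, comp_scons]
  | lam K A hA => simp [Ty.rename, unfold, hA, Ty.rename_comp_upSubst]
  | app A B hA hB => simp [Ty.rename, unfold, hA, hB]

theorem unfold_upSubst_shift (A : Ty) (σ : ℕ → Ty) :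
    unfold (Ty.upSubst σ) A.shift = (unfold σ A).shift := by
  simp only [Ty.shift, unfold_rename, rename_unfold]; rfl

theorem subst_unfold (A : Ty) (σ τ : ℕ → Ty) :
    (unfold σ A).subst τ = unfold (Ty.subst τ ∘ σ) A := by
  induction A generalizing σ τ with
  | var n => rfl
  | top => rfl
  | arrow A B hA hB => simp [Ty.subst, unfold, hA, hB]
  | all K A B hA hB => simp [Ty.subst, unfold, hA, hB, comp_scons]
  | lam K A hA => simp [Ty.subst, unfold, hA, Ty.subst_comp_upSubst]
  | app A B hA hB => simp [Ty.subst, unfold, hA, hB]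

theorem unfold_subst (A : Ty) (σ τ : ℕ → Ty) :
    unfold σ (A.subst τ) = unfold (unfold σ ∘ τ) A := by
  induction A generalizing σ τ with
  | var n => rfl
  | top => rfl
  | arrow A B hA hB => simp [Ty.subst, unfold, hA, hB]
  | all K A B hA hB =>
    simp only [Ty.subst, unfold, hA, hB]
    congr 2
    funext n
    cases n with
    | zero => rfl
    | succ n => exact unfold_scons_shift _ _ _
  | lam K A hA =>
    simp only [Ty.subst, unfold, hA]
    congr 2
    funext n
    cases n with
    | zero => rfl
    | succ n => exact unfold_upSubst_shift _ _
  | app A B hA hB => simp [Ty.subst, unfold, hA, hB]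

theorem inst_unfold (A B : Ty) (σ : ℕ → Ty) :
    (unfold (Ty.upSubst σ) A).inst B = unfold (Ty.scons B σ) A := by
  rw [Ty.inst, subst_unfold, Ty.subst_single_comp_upSubst]

theorem unfold_inst (A B : Ty) (σ : ℕ → Ty) :
    unfold σ (A.inst B) = (unfold (Ty.upSubst σ) A).inst (unfold σ B) := by
  rw [inst_unfold, Ty.inst, unfold_subst]
  congr 1; funext n; cases n <;> rfl

theorem reds_unfold (A : Ty) {σ τ : ℕ → Ty} (h : ∀ n, Reds (σ n) (τ n)) :
    Reds (unfold σ A) (unfold τ A) := by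
  induction A generalizing σ τ with
  | var n => exact h n
  | top => exact .refl
  | arrow A B hA hB => exact (hA h).arrow (hB h)
  | all K A B hA hB =>
    refine (hA h).arrow (hB fun n => ?_)
    cases n with
    | zero => exact hA h
    | succ n => exact h n
  | lam K A hA =>
    refine (hA fun n => ?_).lam K
    cases n with
    | zero => exact .refl
    | succ n => exact (h n).rename _
  | app A B hA hB => exact (hA h).app (hB h)

/-- A step inside a bound is repeated in every copy of the bound within the body. The copy kept as
the domain of the arrow guarantees at least one step even if the body does not mention the variable.
-/
theorem Beta.unfold {A B : Ty} (h : Beta A B) (σ : ℕ → Ty) :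
    Relation.TransGen Beta (unfold σ A) (unfold σ B) := by
  have lift {f : Ty → Ty} (hf : ∀ {A B}, Beta A B → Beta (f A) (f B)) {A B : Ty}
      (h : Relation.TransGen Beta A B) : Relation.TransGen Beta (f A) (f B) := by
    induction h with
    | single h => exact .single (hf h)
    | tail _ h ih => exact ih.tail (hf h)
  induction h generalizing σ with
  | beta K A B => rw [unfold_inst]; exact .single (.beta K _ _)
  | arrowL B _ ih => exact lift (f := (Ty.arrow · _)) (fun h => .arrowL _ h) (ih σ)
  | arrowR A _ ih => exact lift (fun h => .arrowR _ h) (ih σ)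
  | @allL K A A' B _ ih =>
    refine (lift (f := (Ty.arrow · _)) (fun h => .arrowL _ h) (ih σ)).trans_left ?_
    refine Reds.arrow .refl (reds_unfold B fun n => ?_)
    cases n with
    | zero => exact (ih σ).to_reflTransGen
    | succ n => exact .refl
  | allR K A _ ih => exact lift (fun h => .arrowR _ h) (ih _)
  | lam K _ ih => exact lift (fun h => .lam K h) (ih _)
  | appL B _ ih => exact lift (f := (Ty.app · _)) (fun h => .appL _ h) (ih σ)
  | appR A _ ih => exact lift (fun h => .appR _ h) (ih σ)

/-- The fundamental lemma of the reducibility argument. The image of a quantifier may be an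
ill-kinded arrow, since its bound can have a higher kind; reducibility at `⋆` asks only for strong
normalization of the components. -/
theorem Kinded.reducible {Δ : List Knd} {A : Ty} {K : Knd} {σ : ℕ → Ty} (h : Kinded Δ A K)
    (hσ : ∀ n K, Δ[n]? = some K → Reducible K (σ n)) : Reducible K (unfold σ A) := by
  have cons {Δ : List Knd} {σ : ℕ → Ty} {B : Ty} {K₀ : Knd} (hB : Reducible K₀ B)
      (hσ : ∀ n K, Δ[n]? = some K → Reducible K (σ n)) (n : ℕ) (K : Knd)
      (h : (K₀ :: Δ)[n]? = some K) : Reducible K (Ty.scons B σ n) := by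
    cases n with
    | zero => obtain rfl : K₀ = K := by simpa using h
              exact hB
    | succ n => exact hσ n K h
  induction h generalizing σ with
  | var h => exact hσ _ _ h
  | top => exact .intro fun B h => by cases h
  | arrow _ _ hA hB => exact SN.arrow (hA hσ) (hB hσ)
  | all _ _ hA hB => exact SN.arrow (hA hσ).sn (hB (cons (hA hσ) hσ))
  | lam _ hA =>
    refine Reducible.lam fun B hB => ?_
    rw [inst_unfold]
    exact hA (cons hB hσ)
  | app _ _ hA hB => exact hA hσ _ (hB hσ)

theorem SN.acc {A : Ty} (h : SN A) : Acc (fun B A => Beta A B) A := by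
  induction h with
  | intro _ ih => exact .intro _ fun B hB => ih B hB

/-- Each step has a nonempty image, so an infinite reduction of `A` would give one of its unfolding.
-/
theorem SN.of_unfold {A : Ty} {σ : ℕ → Ty} (h : SN (FOmegaSub.unfold σ A)) : SN A := by
  have h' : Acc (fun B A => Relation.TransGen Beta A B) (FOmegaSub.unfold σ A) :=
    Subrelation.accessible (fun h => Relation.transGen_swap.1 h) h.acc.transGen
  clear h
  generalize hB : FOmegaSub.unfold σ A = B at h'
  induction h' generalizing A with
  | intro _ _ ih =>
    subst hB
    exact .intro fun B hB => ih _ (hB.unfold σ) rfl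

theorem Kinded.sn {Δ : List Knd} {A : Ty} {K : Knd} (h : Kinded Δ A K) : SN A :=
  (h.reducible fun n K _ => .var K n).sn.of_unfold

/-! ### Promotion -/

/-- Contexts of the algorithm: `some U` declares a variable with bound `U`, and `none` a variable
which is only below itself and the top type. -/
abbrev Bounds : Type := List (Option Ty)

/-- The bound of a variable, weakened to the whole context. -/
def bound : Bounds → ℕ → Option Ty
  | [], _ => none
  | o :: _, 0 => o.map Ty.shift
  | _ :: D, n + 1 => (bound D n).map Ty.shift

/-- `Promote D A B`: the type `B` is `A` with its head variable replaced by the bound of it. -/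
inductive Promote (D : Bounds) : Ty → Ty → Prop
  | var {n : ℕ} {U : Ty} : bound D n = some U → Promote D (.var n) U
  | app {A A' : Ty} (C : Ty) : Promote D A A' → Promote D (.app A C) (.app A' C)

theorem bound_cons_succ {o : Option Ty} {D : Bounds} {n : ℕ} {U : Ty} :
    bound (o :: D) (n + 1) = some U ↔ ∃ V, bound D n = some V ∧ V.shift = U := by
  simp [bound]

theorem bound_cons_zero {o : Option Ty} {D : Bounds} {U : Ty} :
    bound (o :: D) 0 = some U ↔ ∃ V, o = some V ∧ V.shift = U := by
  simp [bound]

/-- `D'` assigns bounds to the same variables as `D`, and they are `β`-equal. -/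
def BoundsEq (D D' : Bounds) : Prop :=
  ∀ n U, bound D n = some U → ∃ U', bound D' n = some U' ∧ BetaEq U U'

theorem BoundsEq.refl (D : Bounds) : BoundsEq D D := fun _ U h => ⟨U, h, .refl _⟩

theorem BoundsEq.none {D D' : Bounds} (h : BoundsEq D D') :
    BoundsEq (none :: D) (none :: D') := by
  intro n U hU
  cases n with
  | zero => simp [bound] at hU
  | succ n =>
    obtain ⟨V, hV, rfl⟩ := bound_cons_succ.1 hU
    obtain ⟨V', hV', e⟩ := h n V hV
    exact ⟨_, bound_cons_succ.2 ⟨_, hV', rfl⟩, e.shift⟩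

theorem BoundsEq.some {D D' : Bounds} (h : BoundsEq D D') {A A' : Ty} (hA : BetaEq A A') :
    BoundsEq (some A :: D) (some A' :: D') := by
  intro n U hU
  cases n with
  | zero =>
    obtain ⟨V, hV, rfl⟩ := bound_cons_zero.1 hU
    cases hV
    exact ⟨_, rfl, hA.shift⟩
  | succ n =>
    obtain ⟨V, hV, rfl⟩ := bound_cons_succ.1 hU
    obtain ⟨V', hV', e⟩ := h n V hV
    exact ⟨_, bound_cons_succ.2 ⟨_, hV', rfl⟩, e.shift⟩

/-! ### Head variables: promotion commutes with reduction. -/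

namespace Promote

variable {D : Bounds}

theorem unique {A B C : Ty} (h : Promote D A B) (h' : Promote D A C) : B = C := by
  induction h generalizing C with
  | var h => cases h' with | var h' => exact Option.some.inj (h.symm.trans h')
  | app C _ ih => cases h' with | app _ h' => rw [ih h']

/-- A head variable blocks every redex on the spine, so a step can only happen inside an argument,
and arguments are untouched by promotion. -/
theorem beta {A B A' : Ty} (h : Promote D A B) (hA : Beta A A') :
    ∃ B', Promote D A' B' ∧ Beta B B' := by
  induction h generalizing A' with
  | var h => cases hA
  | app C h ih =>
    cases hA with
    | beta => cases h
    | appL _ hA =>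
      obtain ⟨B', hB, hb⟩ := ih hA
      exact ⟨_, .app C hB, .appL C hb⟩
    | appR _ hC => exact ⟨_, .app _ h, .appR _ hC⟩

theorem reds {A B A' : Ty} (h : Promote D A B) (hA : Reds A A') :
    ∃ B', Promote D A' B' ∧ Reds B B' := by
  induction hA with
  | refl => exact ⟨B, h, .refl⟩
  | tail _ hb ih =>
    obtain ⟨B', hB, hr⟩ := ih
    obtain ⟨B'', hB', hb'⟩ := hB.beta hb
    exact ⟨B'', hB', hr.tail hb'⟩

theorem boundsEq {D' : Bounds} (hD : BoundsEq D D') {A B : Ty} (h : Promote D A B) :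
    ∃ B', Promote D' A B' ∧ BetaEq B B' := by
  induction h with
  | var h =>
    obtain ⟨U, hU, e⟩ := hD _ _ h
    exact ⟨U, .var hU, e⟩
  | app C _ ih =>
    obtain ⟨B', hB, e⟩ := ih
    exact ⟨_, .app C hB, e.app (.refl _)⟩

theorem subst {D' : Bounds} {σ : ℕ → Ty}
    (hσ : ∀ n U, bound D n = some U → ∃ m, σ n = .var m ∧ bound D' m = some (U.subst σ))
    {A B : Ty} (h : Promote D A B) : Promote D' (A.subst σ) (B.subst σ) := by
  induction h with
  | var h =>
    obtain ⟨m, hm, hU⟩ := hσ _ _ h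
    simp only [Ty.subst, hm]
    exact .var hU
  | app C _ ih => exact .app _ ih

/-- Reduction preserves the presence of a head variable, so a promotable type never becomes equal to
a type with another outermost constructor. The next three statements have the same reason. -/
theorem not_betaEq_lam {A B C : Ty} {K : Knd} (h : Promote D A B) : ¬ BetaEq A (.lam K C) := by
  intro e
  obtain ⟨E, hE, hE'⟩ := e.church_rosser
  obtain ⟨_, rfl, _⟩ := hE'.lam_inv
  obtain ⟨_, hp, _⟩ := h.reds hE
  cases hp

theorem not_betaEq_arrow {A B C C' : Ty} (h : Promote D A B) : ¬ BetaEq A (.arrow C C') := by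
  intro e
  obtain ⟨E, hE, hE'⟩ := e.church_rosser
  obtain ⟨_, _, rfl, _⟩ := hE'.arrow_inv
  obtain ⟨_, hp, _⟩ := h.reds hE
  cases hp

theorem not_betaEq_all {A B C C' : Ty} {K : Knd} (h : Promote D A B) :
    ¬ BetaEq A (.all K C C') := by
  intro e
  obtain ⟨E, hE, hE'⟩ := e.church_rosser
  obtain ⟨_, _, rfl, _⟩ := hE'.all_inv
  obtain ⟨_, hp, _⟩ := h.reds hE
  cases hp

theorem not_betaEq_topOf {A B : Ty} {K : Knd} (h : Promote D A B) :
    ¬ BetaEq A (Ty.topOf K) := by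
  intro e
  obtain ⟨_, hp, _⟩ := h.reds (e.reds_of_normal (normal_topOf K))
  cases K <;> cases hp

end Promote

/-! ### Inversion of β-equality at the outermost constructor. -/

namespace BetaEq

theorem reds_arrow {A B C : Ty} (h : BetaEq A (.arrow B C)) :
    ∃ B' C', Reds A (.arrow B' C') ∧ Reds B B' ∧ Reds C C' := by
  obtain ⟨D, hA, hD⟩ := h.church_rosser
  obtain ⟨B', C', rfl, hB, hC⟩ := hD.arrow_inv
  exact ⟨B', C', hA, hB, hC⟩

theorem reds_all {A B C : Ty} {K : Knd} (h : BetaEq A (.all K B C)) :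
    ∃ B' C', Reds A (.all K B' C') ∧ Reds B B' ∧ Reds C C' := by
  obtain ⟨D, hA, hD⟩ := h.church_rosser
  obtain ⟨B', C', rfl, hB, hC⟩ := hD.all_inv
  exact ⟨B', C', hA, hB, hC⟩

theorem reds_lam {A B : Ty} {K : Knd} (h : BetaEq A (.lam K B)) :
    ∃ B', Reds A (.lam K B') ∧ Reds B B' := by
  obtain ⟨D, hA, hD⟩ := h.church_rosser
  obtain ⟨B', rfl, hB⟩ := hD.lam_inv
  exact ⟨B', hA, hB⟩

theorem arrow_inj {A B A' B' : Ty} (h : BetaEq (.arrow A B) (.arrow A' B')) :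
    BetaEq A A' ∧ BetaEq B B' := by
  obtain ⟨C, D, h, hA', hB'⟩ := h.reds_arrow
  obtain ⟨_, _, e, hA, hB⟩ := h.arrow_inv
  cases e
  exact ⟨hA.betaEq.trans hA'.betaEq.symm, hB.betaEq.trans hB'.betaEq.symm⟩

theorem all_inj {K K' : Knd} {A B A' B' : Ty} (h : BetaEq (.all K A B) (.all K' A' B')) :
    K = K' ∧ BetaEq A A' ∧ BetaEq B B' := by
  obtain ⟨C, D, h, hA', hB'⟩ := h.reds_all
  obtain ⟨_, _, e, hA, hB⟩ := h.all_inv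
  cases e
  exact ⟨rfl, hA.betaEq.trans hA'.betaEq.symm, hB.betaEq.trans hB'.betaEq.symm⟩

theorem lam_inj {K K' : Knd} {A A' : Ty} (h : BetaEq (.lam K A) (.lam K' A')) :
    K = K' ∧ BetaEq A A' := by
  obtain ⟨C, h, hA'⟩ := h.reds_lam
  obtain ⟨_, e, hA⟩ := h.lam_inv
  cases e
  exact ⟨rfl, hA.betaEq.trans hA'.betaEq.symm⟩

theorem not_lam_arrow {K : Knd} {A B C : Ty} : ¬ BetaEq (.lam K A) (.arrow B C) := by
  intro h
  obtain ⟨_, _, h, _⟩ := h.reds_arrow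
  obtain ⟨_, e, _⟩ := h.lam_inv
  cases e

theorem not_lam_all {K K' : Knd} {A B C : Ty} : ¬ BetaEq (.lam K A) (.all K' B C) := by
  intro h
  obtain ⟨_, _, h, _⟩ := h.reds_all
  obtain ⟨_, e, _⟩ := h.lam_inv
  cases e

theorem not_arrow_all {K : Knd} {A A' B C : Ty} : ¬ BetaEq (.arrow A A') (.all K B C) := by
  intro h
  obtain ⟨_, _, h, _⟩ := h.reds_all
  obtain ⟨_, _, e, _⟩ := h.arrow_inv
  cases e

theorem not_topOf_arrow {K : Knd} {B C : Ty} : ¬ BetaEq (Ty.topOf K) (.arrow B C) := by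
  intro h
  have := h.symm.reds_of_normal (normal_topOf K)
  obtain ⟨_, _, e, _⟩ := this.arrow_inv
  cases K <;> cases e

theorem not_topOf_all {K K' : Knd} {B C : Ty} : ¬ BetaEq (Ty.topOf K) (.all K' B C) := by
  intro h
  have := h.symm.reds_of_normal (normal_topOf K)
  obtain ⟨_, _, e, _⟩ := this.all_inv
  cases K <;> cases e

end BetaEq

/-! ### Syntax-directed subtyping -/

/-- Syntax-directed subtyping, without transitivity and without kinds. -/
inductive AlgSub : Bounds → Ty → Ty → Prop
  | conv {D : Bounds} {A B : Ty} : BetaEq A B → AlgSub D A B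
  | top {D : Bounds} {A B : Ty} (K : Knd) : Reds B (Ty.topOf K) → AlgSub D A B
  | promote {D : Bounds} {A A₀ A₁ B : Ty} :
      Reds A A₀ → Promote D A₀ A₁ → AlgSub D A₁ B → AlgSub D A B
  | arrow {D : Bounds} {A B A₁ A₂ B₁ B₂ : Ty} :
      Reds A (.arrow A₁ A₂) → Reds B (.arrow B₁ B₂) →
      AlgSub D B₁ A₁ → AlgSub D A₂ B₂ → AlgSub D A B
  | all {D : Bounds} {A B C A' B' : Ty} {K : Knd} :
      Reds A (.all K C A') → Reds B (.all K C B') →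
      AlgSub (some C :: D) A' B' → AlgSub D A B
  | lam {D : Bounds} {A B A' B' : Ty} {K : Knd} :
      Reds A (.lam K A') → Reds B (.lam K B') →
      AlgSub (none :: D) A' B' → AlgSub D A B

/-! ### Congruence, substitution and transitivity of syntax-directed subtyping. -/

namespace AlgSub

/-- Each rule starts by reducing, so by confluence its premises can be reached from any β-equal
types. The bounds are allowed to vary too because going under a quantifier puts its bound into the
context. -/
theorem congr {D D' : Bounds} {A A' B B' : Ty} (h : AlgSub D A B) (hD : BoundsEq D D')
    (hA : BetaEq A A') (hB : BetaEq B B') : AlgSub D' A' B' := by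
  induction h generalizing D' A' B' with
  | conv h => exact .conv ((hA.symm.trans h).trans hB)
  | top K h => exact .top K ((hB.symm.trans h.betaEq).reds_of_normal (normal_topOf K))
  | promote h p _ ih =>
    obtain ⟨E, hE, hE'⟩ := (hA.symm.trans h.betaEq).church_rosser
    obtain ⟨F, pF, hF⟩ := p.reds hE'
    obtain ⟨G, pG, hG⟩ := pF.boundsEq hD
    exact .promote hE pG (ih hD (hF.betaEq.trans hG) hB)
  | arrow h h' _ _ ih₁ ih₂ =>
    obtain ⟨E, F, r, hE, hF⟩ := (hA.symm.trans h.betaEq).reds_arrow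
    obtain ⟨G, H, r', hG, hH⟩ := (hB.symm.trans h'.betaEq).reds_arrow
    exact .arrow r r' (ih₁ hD hG.betaEq hE.betaEq) (ih₂ hD hF.betaEq hH.betaEq)
  | all h h' _ ih =>
    obtain ⟨E, F, r, hE, hF⟩ := (hA.symm.trans h.betaEq).reds_all
    obtain ⟨G, H, r', hG, hH⟩ := (hB.symm.trans h'.betaEq).reds_all
    -- The two sides may reach different reducts of the bound, while the rule `all` wants literally
    -- the same one.
    obtain ⟨C, hC, hC'⟩ := hE.confluent hG
    exact .all (r.trans (hC.all _ .refl)) (r'.trans (hC'.all _ .refl))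
      (ih (hD.some (Reds.betaEq (hE.trans hC))) hF.betaEq hH.betaEq)
  | lam h h' _ ih =>
    obtain ⟨F, r, hF⟩ := (hA.symm.trans h.betaEq).reds_lam
    obtain ⟨H, r', hH⟩ := (hB.symm.trans h'.betaEq).reds_lam
    exact .lam r r' (ih hD.none hF.betaEq hH.betaEq)

theorem left {D : Bounds} {A A' B : Ty} (h : AlgSub D A B) (hA : BetaEq A A') : AlgSub D A' B :=
  h.congr (.refl D) hA (.refl _)

theorem right {D : Bounds} {A B B' : Ty} (h : AlgSub D A B) (hB : BetaEq B B') : AlgSub D A B' :=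
  h.congr (.refl D) (.refl _) hB

/-- Only variables with a bound can be promoted, so only these have to be sent to variables with the
corresponding bound; the others may go to arbitrary types. -/
theorem subst {D D' : Bounds} {σ : ℕ → Ty} {A B : Ty} (h : AlgSub D A B)
    (hσ : ∀ n U, bound D n = some U → ∃ m, σ n = .var m ∧ bound D' m = some (U.subst σ)) :
    AlgSub D' (A.subst σ) (B.subst σ) := by
  have up {D D' : Bounds} {σ : ℕ → Ty} (o : Option Ty)
      (hσ : ∀ n U, bound D n = some U → ∃ m, σ n = .var m ∧ bound D' m = some (U.subst σ))
      (n : ℕ) (U : Ty) (hU : bound (o :: D) n = some U) :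
      ∃ m, Ty.upSubst σ n = .var m ∧
        bound (o.map (Ty.subst σ) :: D') m = some (U.subst (Ty.upSubst σ)) := by
    cases n with
    | zero =>
      obtain ⟨V, rfl, rfl⟩ := bound_cons_zero.1 hU
      exact ⟨0, rfl, by simp [bound, Ty.subst_shift]⟩
    | succ n =>
      obtain ⟨V, hV, rfl⟩ := bound_cons_succ.1 hU
      obtain ⟨m, hm, hm'⟩ := hσ n V hV
      exact ⟨m + 1, by simp [Ty.upSubst, hm, Ty.shift, Ty.rename],
        by simp [bound, hm', Ty.subst_shift]⟩
  induction h generalizing D' σ with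
  | conv h => exact .conv (h.subst σ)
  | top K h => exact .top K (Ty.subst_topOf K σ ▸ h.subst σ)
  | promote h p _ ih => exact .promote (h.subst σ) (p.subst hσ) (ih hσ)
  | arrow h h' _ _ ih₁ ih₂ => exact .arrow (h.subst σ) (h'.subst σ) (ih₁ hσ) (ih₂ hσ)
  | all h h' _ ih => exact .all (h.subst σ) (h'.subst σ) (ih (up (some _) hσ))
  | lam h h' _ ih => exact .lam (h.subst σ) (h'.subst σ) (ih (up none hσ))

/-- This is why abstracted variables are recorded as `none` and not with a top type as bound: no
promotion has to survive their instantiation. -/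
theorem inst {D : Bounds} {A B : Ty} (h : AlgSub (none :: D) A B) (C : Ty) :
    AlgSub D (A.inst C) (B.inst C) := by
  refine h.subst fun n U hU => ?_
  cases n with
  | zero => simp [bound] at hU
  | succ n =>
    obtain ⟨V, hV, rfl⟩ := bound_cons_succ.1 hU
    exact ⟨n, rfl, hV.trans (congrArg some (Ty.inst_shift V C).symm)⟩

/-- Needed for transitivity through a top type. `AlgSub` carries no kinds, so the top type on the
right may have a different kind. -/
theorem betaEq_topOf {D : Bounds} {A B : Ty} {K : Knd} (h : AlgSub D A B)
    (hA : BetaEq A (Ty.topOf K)) : ∃ K', BetaEq B (Ty.topOf K') := by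
  induction h generalizing K with
  | conv h => exact ⟨K, h.symm.trans hA⟩
  | top K' h => exact ⟨K', h.betaEq⟩
  | promote h p _ _ => exact absurd (h.betaEq.symm.trans hA) p.not_betaEq_topOf
  | arrow h _ _ _ _ _ => exact absurd (hA.symm.trans h.betaEq) BetaEq.not_topOf_arrow
  | all h _ _ _ => exact absurd (hA.symm.trans h.betaEq) BetaEq.not_topOf_all
  | @lam _ _ _ _ _ K₁ h h' _ ih =>
    have e := h.betaEq.symm.trans hA
    cases K with
    | star =>
      obtain ⟨_, e', _⟩ := (e.reds_of_normal (normal_topOf .star)).lam_inv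
      cases e'
    | arr K K₂ =>
      obtain ⟨K', hK⟩ := ih e.lam_inj.2
      exact ⟨.arr K₁ K', h'.betaEq.trans (hK.lam K₁)⟩

/-- Composition on the right and on the left are proved together because the domain of an arrow is
contravariant and exchanges the two. -/
theorem trans_aux {D : Bounds} {A B : Ty} (h : AlgSub D A B) :
    (∀ C, AlgSub D B C → AlgSub D A C) ∧ ∀ C, AlgSub D C A → AlgSub D C B := by
  induction h with
  | conv h => exact ⟨fun C hC => hC.left h.symm, fun C hC => hC.right h⟩
  | top K h =>
    refine ⟨fun C hC => ?_, fun C _ => .top K h⟩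
    obtain ⟨K', hK⟩ := hC.betaEq_topOf h.betaEq
    exact .top K' (hK.reds_of_normal (normal_topOf K'))
  | @promote D A A₀ A₁ B h p hs ih =>
    refine ⟨fun C hC => .promote h p (ih.1 C hC), fun C hC => ?_⟩
    have hB := AlgSub.promote h p hs
    clear hs ih
    -- The right-hand type of `hC` has a head variable up to reduction, so `hC` is a series of
    -- promotions ending in a conversion; the induction peels off the promotions.
    induction hC with
    | conv e => exact hB.left e.symm
    | top K h' => exact absurd (h.betaEq.symm.trans h'.betaEq) p.not_betaEq_topOf
    | promote h₁ p₁ _ ih₁ => exact .promote h₁ p₁ (ih₁ h p hB)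
    | arrow _ h' _ _ _ _ => exact absurd (h.betaEq.symm.trans h'.betaEq) p.not_betaEq_arrow
    | all _ h' _ _ => exact absurd (h.betaEq.symm.trans h'.betaEq) p.not_betaEq_all
    | lam _ h' _ _ => exact absurd (h.betaEq.symm.trans h'.betaEq) p.not_betaEq_lam
  | @arrow D A B A₁ A₂ B₁ B₂ hA hB h₁ h₂ ih₁ ih₂ =>
    constructor
    · intro C hC
      cases hC with
      | conv e => exact (AlgSub.arrow hA hB h₁ h₂).right e
      | top K h => exact .top K h
      | promote h p _ => exact absurd (h.betaEq.symm.trans hB.betaEq) p.not_betaEq_arrow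
      | arrow h h' k₁ k₂ =>
        obtain ⟨e₁, e₂⟩ := (hB.betaEq.symm.trans h.betaEq).arrow_inj
        exact .arrow hA h' (ih₁.2 _ (k₁.right e₁.symm)) (ih₂.1 _ (k₂.left e₂.symm))
      | all h _ _ => exact absurd (hB.betaEq.symm.trans h.betaEq) BetaEq.not_arrow_all
      | lam h _ _ => exact absurd (h.betaEq.symm.trans hB.betaEq) BetaEq.not_lam_arrow
    · intro C hC
      generalize hD : D = D' at hC
      generalize hE : A = E at hC
      induction hC with
      | conv e => subst hE; subst hD; exact (AlgSub.arrow hA hB h₁ h₂).left e.symm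
      | top K h => subst hE; exact absurd (h.betaEq.symm.trans hA.betaEq) BetaEq.not_topOf_arrow
      | promote h p _ ih => exact .promote h p (ih hD hE)
      | arrow h h' k₁ k₂ =>
        subst hE; subst hD
        obtain ⟨e₁, e₂⟩ := (hA.betaEq.symm.trans h'.betaEq).arrow_inj
        exact .arrow h hB (ih₁.1 _ (k₁.left e₁.symm)) (ih₂.2 _ (k₂.right e₂.symm))
      | all _ h' _ =>
        subst hE; exact absurd (hA.betaEq.symm.trans h'.betaEq) BetaEq.not_arrow_all
      | lam _ h' _ =>
        subst hE; exact absurd (h'.betaEq.symm.trans hA.betaEq) BetaEq.not_lam_arrow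
  | @all D A B U A₁ B₁ K hA hB h₁ ih₁ =>
    constructor
    · intro C hC
      cases hC with
      | conv e => exact (AlgSub.all hA hB h₁).right e
      | top K h => exact .top K h
      | promote h p _ => exact absurd (h.betaEq.symm.trans hB.betaEq) p.not_betaEq_all
      | arrow h _ _ _ => exact absurd (h.betaEq.symm.trans hB.betaEq) BetaEq.not_arrow_all
      | all h h' k =>
        obtain ⟨rfl, e₁, e₂⟩ := (hB.betaEq.symm.trans h.betaEq).all_inj
        -- The two derivations use bounds that are only β-equal, so the second is moved to the bound
        -- of the first.
        have := ih₁.1 _ (k.congr ((BoundsEq.refl D).some e₁.symm) e₂.symm (.refl _))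
        exact (AlgSub.all .refl .refl this).congr (.refl D) hA.betaEq.symm
          ((e₁.all _ (.refl _)).trans h'.betaEq.symm)
      | lam h _ _ => exact absurd (h.betaEq.symm.trans hB.betaEq) BetaEq.not_lam_all
    · intro C hC
      generalize hD : D = D' at hC
      generalize hE : A = E at hC
      induction hC with
      | conv e => subst hE; subst hD; exact (AlgSub.all hA hB h₁).left e.symm
      | top K h => subst hE; exact absurd (h.betaEq.symm.trans hA.betaEq) BetaEq.not_topOf_all
      | promote h p _ ih => exact .promote h p (ih hD hE)
      | arrow _ h' _ _ =>
        subst hE; exact absurd (h'.betaEq.symm.trans hA.betaEq) BetaEq.not_arrow_all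
      | all h h' k =>
        subst hE; subst hD
        obtain ⟨rfl, e₁, e₂⟩ := (hA.betaEq.symm.trans h'.betaEq).all_inj
        have := ih₁.2 _ (k.congr ((BoundsEq.refl D).some e₁.symm) (.refl _) e₂.symm)
        exact (AlgSub.all .refl .refl this).congr (.refl D)
          ((e₁.all _ (.refl _)).trans h.betaEq.symm) hB.betaEq.symm
      | lam _ h' _ =>
        subst hE; exact absurd (h'.betaEq.symm.trans hA.betaEq) BetaEq.not_lam_all
  | @lam D A B A₁ B₁ K hA hB h₁ ih₁ =>
    constructor
    · intro C hC
      cases hC with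
      | conv e => exact (AlgSub.lam hA hB h₁).right e
      | top K h => exact .top K h
      | promote h p _ => exact absurd (h.betaEq.symm.trans hB.betaEq) p.not_betaEq_lam
      | arrow h _ _ _ => exact absurd (hB.betaEq.symm.trans h.betaEq) BetaEq.not_lam_arrow
      | all h _ _ => exact absurd (hB.betaEq.symm.trans h.betaEq) BetaEq.not_lam_all
      | lam h h' k =>
        obtain ⟨rfl, e⟩ := (hB.betaEq.symm.trans h.betaEq).lam_inj
        exact .lam hA h' (ih₁.1 _ (k.left e.symm))
    · intro C hC
      generalize hD : D = D' at hC
      generalize hE : A = E at hC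
      induction hC with
      | conv e => subst hE; subst hD; exact (AlgSub.lam hA hB h₁).left e.symm
      | top K' h =>
        subst hE; subst hD
        obtain ⟨K'', hK⟩ := (AlgSub.lam hA hB h₁).betaEq_topOf h.betaEq
        exact .top K'' (hK.reds_of_normal (normal_topOf K''))
      | promote h p _ ih => exact .promote h p (ih hD hE)
      | arrow _ h' _ _ =>
        subst hE; exact absurd (hA.betaEq.symm.trans h'.betaEq) BetaEq.not_lam_arrow
      | all _ h' _ => subst hE; exact absurd (hA.betaEq.symm.trans h'.betaEq) BetaEq.not_lam_all
      | lam h h' k =>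
        subst hE; subst hD
        obtain ⟨rfl, e⟩ := (hA.betaEq.symm.trans h'.betaEq).lam_inj
        exact .lam h hB (ih₁.2 _ (k.right e.symm))

theorem trans {D : Bounds} {A B C : Ty} (h : AlgSub D A B) (h' : AlgSub D B C) : AlgSub D A C :=
  h.trans_aux.1 C h'

end AlgSub

/-! ### Soundness and completeness of syntax-directed subtyping -/

/-- Every bound in `D` is the bound declared in `Γ`. -/
def BoundsSound (Γ : Ctx) (D : Bounds) : Prop :=
  ∀ n U, bound D n = some U → ∃ K, Lookup Γ n U K

/-- Every bound in `Γ`, other than the top types, is recorded in `D`. -/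
def BoundsComplete (Γ : Ctx) (D : Bounds) : Prop :=
  ∀ n U K, Lookup Γ n U K → bound D n = some U ∨ U = Ty.topOf K

theorem BoundsSound.none {Γ : Ctx} {D : Bounds} (h : BoundsSound Γ D) (d : Ty × Knd) :
    BoundsSound (d :: Γ) (none :: D) := by
  intro n U hU
  cases n with
  | zero => simp [bound] at hU
  | succ n =>
    obtain ⟨V, hV, rfl⟩ := bound_cons_succ.1 hU
    obtain ⟨K, hK⟩ := h n V hV
    exact ⟨K, .there _ hK⟩

theorem BoundsSound.some {Γ : Ctx} {D : Bounds} (h : BoundsSound Γ D) (A : Ty) (K : Knd) :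
    BoundsSound ((A, K) :: Γ) (some A :: D) := by
  intro n U hU
  cases n with
  | zero =>
    obtain ⟨V, hV, rfl⟩ := bound_cons_zero.1 hU
    cases hV
    exact ⟨K, .here _ _ _⟩
  | succ n =>
    obtain ⟨V, hV, rfl⟩ := bound_cons_succ.1 hU
    obtain ⟨K, hK⟩ := h n V hV
    exact ⟨K, .there _ hK⟩

theorem BoundsComplete.none {Γ : Ctx} {D : Bounds} (h : BoundsComplete Γ D) (K : Knd) :
    BoundsComplete ((Ty.topOf K, K) :: Γ) (none :: D) := by
  intro n U K hU
  cases hU with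
  | here => exact .inr (Ty.shift_topOf K)
  | there _ hU =>
    rcases h _ _ _ hU with h | rfl
    · exact .inl (bound_cons_succ.2 ⟨_, h, rfl⟩)
    · exact .inr (Ty.shift_topOf K)

theorem BoundsComplete.some {Γ : Ctx} {D : Bounds} (h : BoundsComplete Γ D) (A : Ty) (K : Knd) :
    BoundsComplete ((A, K) :: Γ) (some A :: D) := by
  intro n U K hU
  cases hU with
  | here => exact .inl rfl
  | there _ hU =>
    rcases h _ _ _ hU with h | rfl
    · exact .inl (bound_cons_succ.2 ⟨_, h, rfl⟩)
    · exact .inr (Ty.shift_topOf K)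

theorem Lookup.bound {Γ : Ctx} {n : ℕ} {A : Ty} {K : Knd} (h : Lookup Γ n A K) :
    bound (Γ.map fun d => some d.1) n = some A := by
  induction h with
  | here Γ A K => rfl
  | there d _ ih => simp [FOmegaSub.bound, ih]

theorem boundsComplete_map (Γ : Ctx) : BoundsComplete Γ (Γ.map fun d => some d.1) :=
  fun _ _ _ h => .inl h.bound

theorem boundsSound_map (Γ : Ctx) : BoundsSound Γ (Γ.map fun d => some d.1) := by
  induction Γ with
  | nil => intro n U h; simp [bound] at h
  | cons d Γ ih => exact ih.some d.1 d.2

theorem Promote.sub {Γ : Ctx} {D : Bounds} (hD : BoundsSound Γ D) {A B : Ty} {K : Knd}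
    (h : Promote D A B) (hA : HasKind Γ A K) : Sub Γ A B ∧ HasKind Γ B K := by
  obtain ⟨hΓ, hA⟩ := hasKind_iff.1 hA
  have ok : HasKind Γ .top .star := hasKind_iff.2 ⟨hΓ, .top⟩
  induction h generalizing K with
  | var h =>
    cases hA with
    | var hn =>
      obtain ⟨K', hK⟩ := hD _ _ h
      obtain rfl := Option.some.inj (hn.symm.trans hK.getElem?)
      exact ⟨.var ok hK, hasKind_iff.2 ⟨hΓ, hK.kinded hΓ⟩⟩
  | app C _ ih =>
    cases hA with
    | app hA hC =>
      obtain ⟨hs, hk⟩ := ih (hasKind_iff.2 ⟨hΓ, hA⟩) hA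
      exact ⟨.app hs (hasKind_iff.2 ⟨hΓ, .app hA hC⟩), .app hk (hasKind_iff.2 ⟨hΓ, hC⟩)⟩

theorem HasKind.reds {Γ : Ctx} {A B : Ty} {K : Knd} (h : HasKind Γ A K) (hAB : Reds A B) :
    HasKind Γ B K :=
  have h := hasKind_iff.1 h
  hasKind_iff.2 ⟨h.1, h.2.reds hAB⟩

theorem HasKind.unique {Γ : Ctx} {A : Ty} {K K' : Knd} (h : HasKind Γ A K)
    (h' : HasKind Γ A K') : K = K' :=
  (hasKind_iff.1 h).2.unique (hasKind_iff.1 h').2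

theorem Sub.of_reds {Γ : Ctx} {A B A' B' : Ty} {K : Knd} (hA : HasKind Γ A K)
    (hB : HasKind Γ B K) (rA : Reds A A') (rB : Reds B B') (h : Sub Γ A' B') : Sub Γ A B :=
  (Sub.conv hA (hA.reds rA) rA.betaEq).trans (h.trans (.conv (hB.reds rB) hB rB.betaEq.symm))

theorem AlgSub.sub {D : Bounds} {A B : Ty} (h : AlgSub D A B) {Γ : Ctx} {K : Knd}
    (hD : BoundsSound Γ D) (hA : HasKind Γ A K) (hB : HasKind Γ B K) : Sub Γ A B := by
  induction h generalizing Γ K with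
  | conv h => exact .conv hA hB h
  | top K' h =>
    obtain rfl := (hasKind_iff.1 (hB.reds h)).2.unique (.topOf _ K')
    exact .of_reds hA hB .refl h (.top hA)
  | promote h p _ ih =>
    obtain ⟨hs, hk⟩ := p.sub hD (hA.reds h)
    exact .of_reds hA hB h .refl (hs.trans (ih hD hk hB))
  | arrow h h' _ _ ih₁ ih₂ =>
    have kA := hA.reds h
    have kB := hB.reds h'
    cases kA with
    | arrow hA₁ hA₂ =>
      cases kB with
      | arrow hB₁ hB₂ =>
        exact .of_reds hA hB h h' (.arrow (ih₁ hD hB₁ hA₁) (ih₂ hD hA₂ hB₂) (.arrow hA₁ hA₂))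
  | all h h' _ ih =>
    have kA := hA.reds h
    have kB := hB.reds h'
    cases kA with
    | all hA' =>
      cases kB with
      | all hB' => exact .of_reds hA hB h h' (.all (ih (hD.some _ _) hA' hB') (.all hA'))
  | lam h h' _ ih =>
    have kA := hA.reds h
    have kB := hB.reds h'
    cases kA with
    | lam hA' =>
      cases kB with
      | lam hB' => exact .of_reds hA hB h h' (.lam (ih (hD.none _) hA' hB'))

/-- For two abstractions, both applications contract and `AlgSub.inst` applies. A top type is
closed, so applying one of arrow kind contracts to the top type of the codomain. The kind of `B`
rules out arrows and quantifiers. -/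
theorem AlgSub.app {D : Bounds} {Δ : List Knd} {A B : Ty} {K K' : Knd} (h : AlgSub D A B)
    (hB : Kinded Δ B (.arr K K')) (C : Ty) : AlgSub D (.app A C) (.app B C) := by
  induction h with
  | conv h => exact .conv (h.app (.refl C))
  | top K₀ h =>
    obtain rfl := (hB.reds h).unique (.topOf _ K₀)
    refine .top K' ((h.app .refl).tail ?_)
    have := Beta.beta K (Ty.topOf K') C
    rwa [Ty.inst, Ty.subst_topOf] at this
  | promote h p _ ih => exact .promote (h.app .refl) (.app C p) (ih hB)
  | arrow _ h' _ _ _ _ => cases hB.reds h'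
  | all _ h' _ _ => cases hB.reds h'
  | lam h h' hs _ =>
    exact (hs.inst C).congr (.refl _)
      (Reds.betaEq ((h.app .refl).tail (.beta _ _ _))).symm
      (Reds.betaEq ((h'.app .refl).tail (.beta _ _ _))).symm

/-- A variable whose bound is a top type may go unrecorded in `D`: its inequality is then an
instance of the rule `top`. -/
theorem Sub.algSub {Γ : Ctx} {A B : Ty} (h : Sub Γ A B) {D : Bounds}
    (hD : BoundsComplete Γ D) : AlgSub D A B := by
  induction h generalizing D with
  | conv _ _ h => exact .conv h
  | trans _ _ ih ih' => exact (ih hD).trans (ih' hD)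
  | top h => exact .top _ .refl
  | var _ h =>
    rcases hD _ _ _ h with h | rfl
    · exact .promote .refl (.var h) (.conv (.refl _))
    · exact .top _ .refl
  | lam _ ih => exact .lam .refl .refl (ih (hD.none _))
  | app h hC ih =>
    obtain ⟨_, K, hA, hB⟩ := h.kinded
    cases (hasKind_iff.1 hC).2 with
    | app hA' _ =>
      obtain rfl := hA.unique hA'
      exact (ih hD).app hB _
  | arrow _ _ _ ih ih' => exact .arrow .refl .refl (ih hD) (ih' hD)
  | all _ _ ih => exact .all .refl .refl (ih (hD.some _ _))

theorem subAt_iff {Γ : Ctx} {A B : Ty} {K : Knd} :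
    SubAt Γ A B K ↔ (HasKind Γ A K ∧ HasKind Γ B K) ∧ AlgSub (Γ.map fun d => some d.1) A B :=
  ⟨fun ⟨h, hA, hB⟩ => ⟨⟨hA, hB⟩, h.algSub (boundsComplete_map Γ)⟩,
    fun ⟨⟨hA, hB⟩, h⟩ => ⟨h.sub (boundsSound_map Γ) hA hB, hA, hB⟩⟩

/-! ### Termination -/

/-- `β`-steps and the passage to immediate subterms of arrows and abstractions. -/
inductive Descend : Ty → Ty → Prop
  | beta {A B : Ty} : Beta A B → Descend B A
  | arrowL (A B : Ty) : Descend A (.arrow A B)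
  | arrowR (A B : Ty) : Descend B (.arrow A B)
  | lam (K : Knd) (A : Ty) : Descend A (.lam K A)

/-- A step made after passing to a component can be made in the whole type first, so β-steps can be
moved ahead of such passages; among passages alone the size decreases. -/
theorem SN.acc_descend {A : Ty} (h : SN A) : Acc Descend A := by
  have of_beta (A : Ty) : (∀ B, Beta A B → Acc Descend B) → Acc Descend A := by
    induction A with
    | var n => exact fun _ => .intro _ fun B hB => by cases hB with | beta h => cases h
    | top => exact fun _ => .intro _ fun B hB => by cases hB with | beta h => cases h
    | arrow A B ihA ihB =>
      intro h
      refine .intro _ fun C hC => ?_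
      cases hC with
      | beta hC => exact h C hC
      | arrowL => exact ihA fun A' hA => (h _ (.arrowL B hA)).inv (.arrowL _ _)
      | arrowR => exact ihB fun B' hB => (h _ (.arrowR A hB)).inv (.arrowR _ _)
    | all K A B _ _ =>
      exact fun h => .intro _ fun C hC => by cases hC with | beta hC => exact h C hC
    | lam K A ih =>
      intro h
      refine .intro _ fun C hC => ?_
      cases hC with
      | beta hC => exact h C hC
      | lam => exact ih fun A' hA => (h _ (.lam K hA)).inv (.lam _ _)
    | app A B _ _ =>
      exact fun h => .intro _ fun C hC => by cases hC with | beta hC => exact h C hC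
  induction h with
  | @intro A _ ih => exact of_beta A ih

/-- The smaller problems met by the subtyping algorithm on one side of an inequality. -/
inductive Smaller : Bounds × Ty → Bounds × Ty → Prop
  | beta (D : Bounds) {A B : Ty} : Beta A B → Smaller (D, B) (D, A)
  | promote {D : Bounds} {A B : Ty} : Promote D A B → Smaller (D, B) (D, A)
  | arrowL (D : Bounds) (A B : Ty) : Smaller (D, A) (D, .arrow A B)
  | arrowR (D : Bounds) (A B : Ty) : Smaller (D, B) (D, .arrow A B)
  | all (D : Bounds) (K : Knd) (A B : Ty) : Smaller (some A :: D, B) (D, .all K A B)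
  | lam (D : Bounds) (K : Knd) (A : Ty) : Smaller (none :: D, A) (D, .lam K A)

/-- The number of variables declared no later than the head variable, in a context of length `L`;
`0` for types without head variable. -/
def headRank (L : ℕ) : Ty → ℕ
  | .var n => L - n
  | .app A _ => headRank L A
  | _ => 0

theorem headRank_shift (L : ℕ) (A : Ty) : headRank (L + 1) A.shift = headRank L A := by
  induction A with
  | var n => exact Nat.add_sub_add_right L 1 n
  | app A B hA _ => exact hA
  | _ => rfl

theorem headRank_shift_le (L : ℕ) (A : Ty) : headRank L A.shift ≤ L - 1 := by
  induction A with
  | var n => exact Nat.sub_le_sub_left (Nat.le_add_left 1 n) L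
  | app A B hA _ => exact hA
  | _ => exact Nat.zero_le _

/-- A bound is weakened past its own variable, so its head was declared strictly earlier. Truncated
subtraction gives rank `0` to a head outside the context, so no scoping hypothesis is needed. -/
theorem headRank_bound {D : Bounds} {n : ℕ} {U : Ty} (h : bound D n = some U) :
    headRank D.length U < D.length - n := by
  induction D generalizing n U with
  | nil => simp [bound] at h
  | cons o D ih =>
    cases n with
    | zero =>
      obtain ⟨V, _, rfl⟩ := bound_cons_zero.1 h
      have := headRank_shift_le (D.length + 1) V
      simp only [List.length_cons]
      omega
    | succ n =>
      obtain ⟨V, hV, rfl⟩ := bound_cons_succ.1 h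
      have := ih hV
      simp only [List.length_cons, headRank_shift]
      omega

theorem Promote.headRank_lt {D : Bounds} {A B : Ty} (h : Promote D A B) :
    headRank D.length B < headRank D.length A := by
  induction h with
  | var h => exact headRank_bound h
  | app C _ ih => exact ih

/-- `σ` solves the equations `X = U` for the bounds `U` of the variables `X` in `D`. -/
def Unfolds (σ : ℕ → Ty) (D : Bounds) : Prop :=
  ∀ n U, bound D n = some U → σ n = unfold σ U

theorem Unfolds.some {σ : ℕ → Ty} {D : Bounds} (h : Unfolds σ D) (A : Ty) :
    Unfolds (Ty.scons (unfold σ A) σ) (some A :: D) := by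
  intro n U hU
  cases n with
  | zero =>
    obtain ⟨V, hV, rfl⟩ := bound_cons_zero.1 hU
    cases hV
    rw [unfold_scons_shift]; rfl
  | succ n =>
    obtain ⟨V, hV, rfl⟩ := bound_cons_succ.1 hU
    rw [unfold_scons_shift]; exact h n V hV

theorem Unfolds.none {σ : ℕ → Ty} {D : Bounds} (h : Unfolds σ D) :
    Unfolds (Ty.upSubst σ) (none :: D) := by
  intro n U hU
  cases n with
  | zero => simp [bound] at hU
  | succ n =>
    obtain ⟨V, hV, rfl⟩ := bound_cons_succ.1 hU
    rw [unfold_upSubst_shift, ← h n V hV]; rfl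

theorem Promote.unfold_eq {σ : ℕ → Ty} {D : Bounds} (hσ : Unfolds σ D) {A B : Ty}
    (h : Promote D A B) : unfold σ A = unfold σ B := by
  induction h with
  | var h => exact hσ _ _ h
  | app C _ ih => simp [unfold, ih]

/-- Lexicographic induction on the unfolded type and the head rank. Promotion keeps the first and
lowers the second. Every other move lowers the first; in particular, the body of a quantifier,
unfolded with its bound substituted, is the codomain of the unfolded quantifier. -/
theorem acc_smaller {σ : ℕ → Ty} {D : Bounds} {A : Ty} (hσ : Unfolds σ D)
    (h : SN (unfold σ A)) : Acc Smaller (D, A) := by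
  have h' := h.acc_descend.transGen
  clear h
  generalize hB : unfold σ A = B at h'
  induction h' generalizing σ D A with
  | intro B _ ih =>
    generalize hr : headRank D.length A = r
    induction r using Nat.strong_induction_on generalizing A with
    | _ r ihr =>
      subst hB hr
      refine .intro _ fun p hp => ?_
      cases hp with
      | beta _ h =>
        refine ih _ ?_ hσ rfl
        have := h.unfold σ
        rw [← Relation.transGen_swap]
        exact Relation.TransGen.mono (fun _ _ h => .beta h) _ _ this
      | promote h => exact ihr _ h.headRank_lt (h.unfold_eq hσ).symm rfl
      | arrowL => exact ih _ (.single (.arrowL _ _)) hσ rfl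
      | arrowR => exact ih _ (.single (.arrowR _ _)) hσ rfl
      | all => exact ih _ (.single (.arrowR _ _)) (hσ.some _) rfl
      | lam => exact ih _ (.single (.lam _ _)) hσ.none rfl

/-- The substitution that unfolds all bounds of a context. -/
def unfolding : Ctx → ℕ → Ty
  | [] => Ty.var
  | (A, _) :: Γ => Ty.scons (unfold (unfolding Γ) A) (unfolding Γ)

theorem unfolds_unfolding (Γ : Ctx) : Unfolds (unfolding Γ) (Γ.map fun d => some d.1) := by
  induction Γ with
  | nil => intro n U h; simp [bound] at h
  | cons d Γ ih => exact ih.some d.1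

theorem WellFormed.reducible {Γ : Ctx} (h : WellFormed Γ) : ∀ (n : ℕ) (K : Knd),
    (Γ.map Prod.snd)[n]? = some K → Reducible K (unfolding Γ n) := by
  induction Γ with
  | nil => simp
  | cons d Γ ih =>
    intro n K hn
    cases n with
    | zero =>
      obtain rfl : d.2 = K := by simpa using hn
      exact h.2.reducible (ih h.1)
    | succ n => exact ih h.1 n K hn

theorem HasKind.acc_smaller {Γ : Ctx} {A : Ty} {K : Knd} (h : HasKind Γ A K) :
    Acc Smaller (Γ.map fun d => some d.1, A) := by
  rw [hasKind_iff] at h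
  exact FOmegaSub.acc_smaller (unfolds_unfolding Γ) (h.2.reducible h.1.reducible).sn

/-! ### Antisymmetry -/

theorem Smaller.of_reds (D : Bounds) {A B : Ty} (h : Reds A B) :
    Relation.ReflTransGen Smaller (D, B) (D, A) := by
  induction h with
  | refl => exact .refl
  | tail _ h ih => exact ih.head (.beta D h)

theorem Smaller.acc_reds {D : Bounds} {A B : Ty} (hA : Acc Smaller (D, A)) (h : Reds A B) :
    Acc Smaller (D, B) := by
  induction h with
  | refl => exact hA
  | tail _ h ih => exact ih.inv (.beta D h)

/-- A normal type with a head variable can be reached only by conversion and promotion, and both are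
sequences of moves of `Smaller`. -/
theorem AlgSub.smaller_of_normal {D : Bounds} {A B C : Ty} (h : AlgSub D A B)
    (hB : Normal B) (p : Promote D B C) : Relation.ReflTransGen Smaller (D, B) (D, A) := by
  induction h with
  | conv h => exact Smaller.of_reds _ (h.reds_of_normal hB)
  | top K h => exact absurd h.betaEq p.not_betaEq_topOf
  | promote h p' _ ih => exact ((ih hB p).tail (.promote p')).trans (Smaller.of_reds _ h)
  | arrow _ h' _ _ _ _ => exact absurd h'.betaEq p.not_betaEq_arrow
  | all _ h' _ _ => exact absurd h'.betaEq p.not_betaEq_all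
  | lam _ h' _ _ => exact absurd h'.betaEq p.not_betaEq_lam

theorem not_transGen_of_acc {α : Type*} {r : α → α → Prop} {a : α} (h : Acc r a) :
    ¬ Relation.TransGen r a a := by
  have h' := h.transGen
  clear h
  induction h' with
  | intro a _ ih => exact fun h => ih a h h

/-! ### Inversion of syntax-directed subtyping. -/

namespace AlgSub

theorem arrow_inv {D : Bounds} {A B A₁ A₂ B₁ B₂ : Ty} (h : AlgSub D A B)
    (hA : BetaEq A (.arrow A₁ A₂)) (hB : BetaEq B (.arrow B₁ B₂)) :
    AlgSub D B₁ A₁ ∧ AlgSub D A₂ B₂ := by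
  cases h with
  | conv e =>
    obtain ⟨e₁, e₂⟩ := ((hA.symm.trans e).trans hB).arrow_inj
    exact ⟨.conv e₁.symm, .conv e₂⟩
  | top K h => exact absurd (h.betaEq.symm.trans hB) BetaEq.not_topOf_arrow
  | promote h p _ => exact absurd (h.betaEq.symm.trans hA) p.not_betaEq_arrow
  | arrow h h' k₁ k₂ =>
    obtain ⟨a₁, a₂⟩ := (h.betaEq.symm.trans hA).arrow_inj
    obtain ⟨b₁, b₂⟩ := (h'.betaEq.symm.trans hB).arrow_inj
    exact ⟨k₁.congr (.refl D) b₁ a₁, k₂.congr (.refl D) a₂ b₂⟩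
  | all h _ _ => exact absurd (hA.symm.trans h.betaEq) BetaEq.not_arrow_all
  | lam h _ _ => exact absurd (h.betaEq.symm.trans hA) BetaEq.not_lam_arrow

theorem all_inv {D : Bounds} {A B C A' B' : Ty} {K : Knd} (h : AlgSub D A B)
    (hA : BetaEq A (.all K C A')) (hB : BetaEq B (.all K C B')) :
    AlgSub (some C :: D) A' B' := by
  cases h with
  | conv e => exact .conv ((hA.symm.trans e).trans hB).all_inj.2.2
  | top K h => exact absurd (h.betaEq.symm.trans hB) BetaEq.not_topOf_all
  | promote h p _ => exact absurd (h.betaEq.symm.trans hA) p.not_betaEq_all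
  | arrow h _ _ _ => exact absurd (h.betaEq.symm.trans hA) BetaEq.not_arrow_all
  | all h h' k =>
    obtain ⟨rfl, a₁, a₂⟩ := (h.betaEq.symm.trans hA).all_inj
    exact k.congr ((BoundsEq.refl D).some a₁) a₂ (h'.betaEq.symm.trans hB).all_inj.2.2
  | lam h _ _ => exact absurd (h.betaEq.symm.trans hA) BetaEq.not_lam_all

theorem lam_inv {D : Bounds} {A B A' B' : Ty} {K : Knd} (h : AlgSub D A B)
    (hA : BetaEq A (.lam K A')) (hB : BetaEq B (.lam K B')) :
    AlgSub (none :: D) A' B' := by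
  cases h with
  | conv e => exact .conv ((hA.symm.trans e).trans hB).lam_inj.2
  | top K' h =>
    have e := h.betaEq.symm.trans hB
    cases K' with
    | star =>
      obtain ⟨_, e', _⟩ := (e.symm.reds_of_normal (normal_topOf .star)).lam_inv
      cases e'
    | arr K₁ K₂ => exact .top K₂ (e.lam_inj.2.symm.reds_of_normal (normal_topOf K₂))
  | promote h p _ => exact absurd (h.betaEq.symm.trans hA) p.not_betaEq_lam
  | arrow h _ _ _ => exact absurd (hA.symm.trans h.betaEq) BetaEq.not_lam_arrow
  | all h _ _ => exact absurd (hA.symm.trans h.betaEq) BetaEq.not_lam_all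
  | lam h h' k =>
    obtain ⟨rfl, a⟩ := (h.betaEq.symm.trans hA).lam_inj
    exact k.congr (.refl _) a (h'.betaEq.symm.trans hB).lam_inj.2

end AlgSub

/-- The inequality `h` drives the induction, and `h'` is inverted to follow it. A promotion in `h`
is impossible, by well-foundedness of the moves. -/
theorem AlgSub.antisymm {D : Bounds} {A B : Ty} (h : AlgSub D A B) (h' : AlgSub D B A)
    {Γ : Ctx} {K : Knd} (hD : BoundsSound Γ D) (hA : HasKind Γ A K) (hB : HasKind Γ B K)
    (aA : Acc Smaller (D, A)) (aB : Acc Smaller (D, B)) : BetaEq A B := by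
  induction h generalizing Γ K with
  | conv h => exact h
  | top K' h =>
    -- Both types equal top types, and having the same kind they equal the same one.
    obtain ⟨K'', e⟩ := h'.betaEq_topOf h.betaEq
    obtain rfl := (hA.reds (e.reds_of_normal (normal_topOf K''))).unique
      ((hasKind_iff.2 ⟨(hasKind_iff.1 hA).1, .top⟩ : HasKind Γ .top .star).topOf K'')
    obtain rfl := (hB.reds h).unique
      ((hasKind_iff.2 ⟨(hasKind_iff.1 hA).1, .top⟩ : HasKind Γ .top .star).topOf K')
    exact e.trans h.betaEq.symm
  | promote r p hs _ =>
    -- A cycle arises: the promoted type is below the original one, so the normal form `N` is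
    -- reachable from its own promotion `N'`, which is a move from `N`.
    have back := (hs.trans h').right r.betaEq
    obtain ⟨N, hN, nN⟩ := (hasKind_iff.1 (hA.reds r)).2.sn.exists_normal
    obtain ⟨N', pN, rN⟩ := p.reds hN
    have chain := ((back.left rN.betaEq).right hN.betaEq).smaller_of_normal nN pN
    exact absurd (Relation.TransGen.tail' chain (.promote pN))
      (not_transGen_of_acc (Smaller.acc_reds aA (r.trans hN)))
  | arrow r r' _ _ ih₁ ih₂ =>
    obtain ⟨k₁, k₂⟩ := h'.arrow_inv r'.betaEq r.betaEq
    cases hA.reds r with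
    | arrow hA₁ hA₂ =>
      cases hB.reds r' with
      | arrow hB₁ hB₂ =>
        have a := Smaller.acc_reds aA r
        have b := Smaller.acc_reds aB r'
        have e₁ := ih₁ k₁ hD hB₁ hA₁ (b.inv (.arrowL _ _ _)) (a.inv (.arrowL _ _ _))
        have e₂ := ih₂ k₂ hD hA₂ hB₂ (a.inv (.arrowR _ _ _)) (b.inv (.arrowR _ _ _))
        exact (r.betaEq.trans (e₁.symm.arrow e₂)).trans r'.betaEq.symm
  | all r r' _ ih =>
    have k := h'.all_inv r'.betaEq r.betaEq
    cases hA.reds r with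
    | all hA' =>
      cases hB.reds r' with
      | all hB' =>
        have e := ih k (hD.some _ _) hA' hB' ((Smaller.acc_reds aA r).inv (.all _ _ _ _))
          ((Smaller.acc_reds aB r').inv (.all _ _ _ _))
        exact (r.betaEq.trans (.all _ (.refl _) e)).trans r'.betaEq.symm
  | lam r r' _ ih =>
    have k := h'.lam_inv r'.betaEq r.betaEq
    cases hA.reds r with
    | lam hA' =>
      cases hB.reds r' with
      | lam hB' =>
        have e := ih k (hD.none _) hA' hB' ((Smaller.acc_reds aA r).inv (.lam _ _ _))
          ((Smaller.acc_reds aB r').inv (.lam _ _ _))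
        exact (r.betaEq.trans (.lam _ e)).trans r'.betaEq.symm

theorem Sub.antisymm {Γ : Ctx} {A B : Ty} {K : Knd} (h : Sub Γ A B) (h' : Sub Γ B A)
    (hA : HasKind Γ A K) (hB : HasKind Γ B K) : BetaEq A B :=
  (h.algSub (boundsComplete_map Γ)).antisymm (h'.algSub (boundsComplete_map Γ))
    (boundsSound_map Γ) hA hB hA.acc_smaller hB.acc_smaller

/-! ### The subtyping algorithm -/

namespace Ty

/-- The components of an arrow type. -/
def asArrow : Ty → Option (Ty × Ty)
  | .arrow A B => some (A, B)
  | _ => none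

/-- The components of a quantified type. -/
def asAll : Ty → Option (Knd × Ty × Ty)
  | .all K A B => some (K, A, B)
  | _ => none

/-- The components of an abstraction. -/
def asLam : Ty → Option (Knd × Ty)
  | .lam K A => some (K, A)
  | _ => none

theorem asLam_eq_some {A : Ty} {p : Knd × Ty} : A.asLam = some p ↔ A = .lam p.1 p.2 := by
  cases A <;> simp [asLam, Prod.ext_iff]

/-- Whether a type is one of the top types `T_K`. -/
def isTop : Ty → Bool
  | .top => true
  | .lam _ A => isTop A
  | _ => false

theorem isTop_iff {A : Ty} : A.isTop = true ↔ ∃ K, A = topOf K := by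
  constructor
  · intro h
    induction A with
    | top => exact ⟨.star, rfl⟩
    | lam K A ih =>
      obtain ⟨K', rfl⟩ := ih h
      exact ⟨.arr K K', rfl⟩
    | _ => cases h
  · rintro ⟨K, rfl⟩
    induction K with
    | star => rfl
    | arr K K' _ ih => exact ih

end Ty

/-- The leftmost `β`-step of a type, if there is one. -/
def reduceStep : Ty → Option Ty
  | .var _ => none
  | .top => none
  | .arrow A B => (reduceStep A).map (Ty.arrow · B) <|> (reduceStep B).map (Ty.arrow A)
  | .all K A B => (reduceStep A).map (Ty.all K · B) <|> (reduceStep B).map (Ty.all K A)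
  | .lam K A => (reduceStep A).map (Ty.lam K)
  | .app A B => A.asLam.map (fun p => p.2.inst B) <|>
      ((reduceStep A).map (Ty.app · B) <|> (reduceStep B).map (Ty.app A))

theorem reduceStep_beta {A B : Ty} (h : reduceStep A = some B) : Beta A B := by
  induction A generalizing B with
  | var n => cases h
  | top => cases h
  | arrow A₁ A₂ ih₁ ih₂ =>
    simp only [reduceStep, Option.orElse_eq_orElse, Option.orElse_eq_or, Option.or_eq_some_iff,
      Option.map_eq_some_iff] at h
    rcases h with ⟨C, hC, rfl⟩ | ⟨_, C, hC, rfl⟩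
    · exact .arrowL _ (ih₁ hC)
    · exact .arrowR _ (ih₂ hC)
  | all K A₁ A₂ ih₁ ih₂ =>
    simp only [reduceStep, Option.orElse_eq_orElse, Option.orElse_eq_or, Option.or_eq_some_iff,
      Option.map_eq_some_iff] at h
    rcases h with ⟨C, hC, rfl⟩ | ⟨_, C, hC, rfl⟩
    · exact .allL _ _ (ih₁ hC)
    · exact .allR _ _ (ih₂ hC)
  | lam K A ih =>
    simp only [reduceStep, Option.map_eq_some_iff] at h
    obtain ⟨C, hC, rfl⟩ := h
    exact .lam _ (ih hC)
  | app A₁ A₂ ih₁ ih₂ =>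
    simp only [reduceStep, Option.orElse_eq_orElse, Option.orElse_eq_or, Option.or_eq_some_iff,
      Option.map_eq_some_iff, Ty.asLam_eq_some] at h
    rcases h with ⟨C, rfl, rfl⟩ | ⟨_, ⟨C, hC, rfl⟩ | ⟨_, C, hC, rfl⟩⟩
    · exact .beta _ _ _
    · exact .appL _ (ih₁ hC)
    · exact .appR _ (ih₂ hC)

theorem normal_of_reduceStep {A : Ty} (h : reduceStep A = none) : Normal A := by
  induction A with
  | var n => intro B hB; cases hB
  | top => intro B hB; cases hB
  | arrow A₁ A₂ ih₁ ih₂ =>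
    simp only [reduceStep, Option.orElse_eq_orElse, Option.orElse_eq_or, Option.or_eq_none_iff,
      Option.map_eq_none_iff] at h
    intro B hB
    cases hB with
    | arrowL _ hB => exact ih₁ h.1 _ hB
    | arrowR _ hB => exact ih₂ h.2 _ hB
  | all K A₁ A₂ ih₁ ih₂ =>
    simp only [reduceStep, Option.orElse_eq_orElse, Option.orElse_eq_or, Option.or_eq_none_iff,
      Option.map_eq_none_iff] at h
    intro B hB
    cases hB with
    | allL _ _ hB => exact ih₁ h.1 _ hB
    | allR _ _ hB => exact ih₂ h.2 _ hB
  | lam K A ih =>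
    simp only [reduceStep, Option.map_eq_none_iff] at h
    intro B hB
    cases hB with
    | lam _ hB => exact ih h _ hB
  | app A₁ A₂ ih₁ ih₂ =>
    simp only [reduceStep, Option.orElse_eq_orElse, Option.orElse_eq_or, Option.or_eq_none_iff,
      Option.map_eq_none_iff] at h
    intro B hB
    cases hB with
    | beta => cases h.1
    | appL _ hB => exact ih₁ h.2.1 _ hB
    | appR _ hB => exact ih₂ h.2.2 _ hB

/-- The promotion of a type, if it has a head variable with a bound. -/
def promoteHead (D : Bounds) : Ty → Option Ty
  | .var n => bound D n
  | .app A C => (promoteHead D A).map (Ty.app · C)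
  | _ => none

theorem promoteHead_eq_some {D : Bounds} {A B : Ty} :
    promoteHead D A = some B ↔ Promote D A B := by
  constructor
  · intro h
    induction A generalizing B with
    | var n => exact .var h
    | app A C ih _ =>
      obtain ⟨A', hA, rfl⟩ := Option.map_eq_some_iff.1 h
      exact .app C (ih hA)
    | _ => cases h
  · intro h
    induction h with
    | var h => exact h
    | app C _ ih => simp [promoteHead, ih]

/-- A subtyping problem `D ⊢ A ≤ B`. -/
abbrev Goal : Type := Bounds × Ty × Ty

/-- A subtyping problem has a positive answer. -/
def Goal.Holds (g : Goal) : Prop := AlgSub g.1 g.2.1 g.2.2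

/-- The problems to which a comparison of two types with the same outermost constructor reduces. -/
def compareHeads (g : Goal) : Option (List Goal) :=
  (g.2.1.asArrow.bind fun a => g.2.2.asArrow.map fun b =>
    [(g.1, b.1, a.1), (g.1, a.2, b.2)]) <|>
  ((g.2.1.asAll.bind fun a => g.2.2.asAll.bind fun b =>
    if a.1 = b.1 ∧ a.2.1 = b.2.1 then some [(some a.2.1 :: g.1, a.2.2, b.2.2)] else none) <|>
  (g.2.1.asLam.bind fun a => g.2.2.asLam.bind fun b =>
    if a.1 = b.1 then some [(none :: g.1, a.2, b.2)] else none))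

/-- One step of the subtyping algorithm: the problems to which a problem reduces, or `none` if the
answer is negative. -/
def nextGoals (g : Goal) : Option (List Goal) :=
  (reduceStep g.2.1).map (fun A => [(g.1, A, g.2.2)]) <|>
  ((reduceStep g.2.2).map (fun B => [(g.1, g.2.1, B)]) <|>
  (if g.2.2.isTop = true ∨ g.2.1 = g.2.2 then some [] else
  ((promoteHead g.1 g.2.1).map (fun A => [(g.1, A, g.2.2)]) <|> compareHeads g)))

theorem compareHeads_eq_some {D : Bounds} {A B : Ty} {gs : List Goal} :
    compareHeads (D, A, B) = some gs ↔
      (∃ A₁ A₂ B₁ B₂, A = .arrow A₁ A₂ ∧ B = .arrow B₁ B₂ ∧ gs = [(D, B₁, A₁), (D, A₂, B₂)]) ∨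
      (∃ K C A' B', A = .all K C A' ∧ B = .all K C B' ∧ gs = [(some C :: D, A', B')]) ∨
      ∃ K A' B', A = .lam K A' ∧ B = .lam K B' ∧ gs = [(none :: D, A', B')] := by
  cases A <;> cases B <;> simp [compareHeads, Ty.asArrow, Ty.asAll, Ty.asLam, eq_comm]

/-- The two types of a problem with their context, as an unordered pair. -/
def Goal.sides (g : Goal) : Sym2 (Bounds × Ty) := s((g.1, g.2.1), (g.1, g.2.2))

theorem Goal.sides_lt {p p' q q' : Bounds × Ty} (h : Smaller p p') (h' : Smaller q q') :
    Relation.TransGen (Sym2.GameAdd Smaller) s(p, q) s(p', q') :=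
  .head (Sym2.GameAdd.fst h) (.single (Sym2.GameAdd.snd h'))

/-- A step moves on one side or on both, so the pair of sides decreases in the game sum. The pair is
unordered since arrow domains are compared in the opposite direction. -/
theorem nextGoals_sides {g : Goal} {gs : List Goal} (h : nextGoals g = some gs) :
    ∀ g' ∈ gs, Relation.TransGen (Sym2.GameAdd Smaller) (Goal.sides g') g.sides := by
  obtain ⟨D, A, B⟩ := g
  simp only [nextGoals, Option.orElse_eq_orElse, Option.orElse_eq_or, Option.or_eq_some_iff,
    Option.map_eq_some_iff] at h
  rcases h with ⟨A', hA, rfl⟩ | ⟨_, ⟨B', hB, rfl⟩ | ⟨_, h⟩⟩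
  · simpa [Goal.sides] using .single (Sym2.GameAdd.fst (.beta D (reduceStep_beta hA)))
  · simpa [Goal.sides] using .single (Sym2.GameAdd.snd (.beta D (reduceStep_beta hB)))
  split_ifs at h with ht
  · cases h; simp
  · simp only [Option.or_eq_some_iff, Option.map_eq_some_iff, compareHeads_eq_some] at h
    rcases h with ⟨A', hA, rfl⟩ | ⟨_, ⟨A₁, A₂, B₁, B₂, rfl, rfl, rfl⟩ |
      ⟨K, C, A', B', rfl, rfl, rfl⟩ | ⟨K, A', B', rfl, rfl, rfl⟩⟩
    · simpa [Goal.sides] using .single (Sym2.GameAdd.fst (.promote (promoteHead_eq_some.1 hA)))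
    · simp only [List.mem_cons, List.not_mem_nil, or_false, forall_eq_or_imp, forall_eq]
      refine ⟨?_, Goal.sides_lt (.arrowR _ _ _) (.arrowR _ _ _)⟩
      rw [Goal.sides, Sym2.eq_swap]
      exact Goal.sides_lt (.arrowL _ _ _) (.arrowL _ _ _)
    · simpa [Goal.sides] using Goal.sides_lt (.all D K C A') (.all D K C B')
    · simpa [Goal.sides] using Goal.sides_lt (.lam D K A') (.lam D K B')

/-- Between normal types β-equality is identity, so bounds of quantifiers may be compared
syntactically. -/
theorem compareHeads_holds {D : Bounds} {A B : Ty} (hA : Normal A) (hB : Normal B)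
    (hp : promoteHead D A = none) (ht : ¬ (B.isTop = true ∨ A = B)) :
    AlgSub D A B ↔ ∃ gs, compareHeads (D, A, B) = some gs ∧ ∀ g ∈ gs, Goal.Holds g := by
  simp only [compareHeads_eq_some]
  constructor
  · intro h
    cases h with
    | conv h => exact absurd (.inr (hA.eq_of_reds (h.reds_of_normal hB)).symm) ht
    | top K h => exact absurd (.inl (Ty.isTop_iff.2 ⟨K, (hB.eq_of_reds h).symm⟩)) ht
    | promote h p _ =>
      obtain rfl := hA.eq_of_reds h
      cases hp.symm.trans (promoteHead_eq_some.2 p)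
    | arrow h h' k₁ k₂ =>
      exact ⟨_, .inl ⟨_, _, _, _, (hA.eq_of_reds h).symm, (hB.eq_of_reds h').symm, rfl⟩,
        by simpa [Goal.Holds] using ⟨k₁, k₂⟩⟩
    | all h h' k =>
      exact ⟨_, .inr (.inl ⟨_, _, _, _, (hA.eq_of_reds h).symm, (hB.eq_of_reds h').symm, rfl⟩),
        by simpa [Goal.Holds] using k⟩
    | lam h h' k =>
      exact ⟨_, .inr (.inr ⟨_, _, _, (hA.eq_of_reds h).symm, (hB.eq_of_reds h').symm, rfl⟩),
        by simpa [Goal.Holds] using k⟩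
  · rintro ⟨gs, ⟨A₁, A₂, B₁, B₂, rfl, rfl, rfl⟩ | ⟨K, C, A', B', rfl, rfl, rfl⟩ |
      ⟨K, A', B', rfl, rfl, rfl⟩, h⟩
    · simp only [List.mem_cons, List.not_mem_nil, or_false, forall_eq_or_imp, forall_eq] at h
      exact .arrow .refl .refl h.1 h.2
    · exact .all .refl .refl (h _ (List.mem_singleton_self _))
    · exact .lam .refl .refl (h _ (List.mem_singleton_self _))

/-- No backtracking is needed: reducing either side preserves the answer, and for a normal type with
a bounded head variable, once the top and equality tests have failed, promotion is the only
applicable rule. -/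
theorem nextGoals_holds (g : Goal) :
    g.Holds ↔ ∃ gs, nextGoals g = some gs ∧ ∀ g' ∈ gs, Goal.Holds g' := by
  obtain ⟨D, A, B⟩ := g
  simp only [nextGoals, Option.orElse_eq_orElse, Option.orElse_eq_or]
  rcases hA : reduceStep A with _ | A'
  · have nA := normal_of_reduceStep hA
    rcases hB : reduceStep B with _ | B'
    · have nB := normal_of_reduceStep hB
      simp only [Option.map_none, Option.none_or]
      split_ifs with ht
      · simp only [Option.some.injEq, exists_eq_left', List.not_mem_nil, false_imp_iff,
          implies_true, iff_true]
        rcases ht with ht | rfl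
        · obtain ⟨K, rfl⟩ := Ty.isTop_iff.1 ht
          exact .top K .refl
        · exact .conv (.refl _)
      · rcases hp : promoteHead D A with _ | A'
        · simpa using! compareHeads_holds nA nB hp ht
        · have p := promoteHead_eq_some.1 hp
          simp only [Option.map_some, Option.some_or, Option.some.injEq, exists_eq_left',
            List.mem_singleton, forall_eq]
          refine ⟨fun h => ?_, fun h => .promote .refl p h⟩
          cases h with
          | conv h => exact absurd (.inr (nA.eq_of_reds (h.reds_of_normal nB)).symm) ht
          | top K h => exact absurd (.inl (Ty.isTop_iff.2 ⟨K, (nB.eq_of_reds h).symm⟩)) ht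
          | promote h p' k =>
            obtain rfl := nA.eq_of_reds h
            rwa [p.unique p']
          | arrow h => exact absurd (Reds.betaEq h) p.not_betaEq_arrow
          | all h => exact absurd (Reds.betaEq h) p.not_betaEq_all
          | lam h => exact absurd (Reds.betaEq h) p.not_betaEq_lam
    · have b : BetaEq B B' := .rel _ _ (reduceStep_beta hB)
      simp only [Option.map_none, Option.none_or, Option.map_some, Option.some_or,
        Option.some.injEq, exists_eq_left', List.mem_singleton, forall_eq]
      exact ⟨fun h => AlgSub.right h b, fun h => AlgSub.right h b.symm⟩
  · have b : BetaEq A A' := .rel _ _ (reduceStep_beta hA)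
    simp only [Option.map_some, Option.some_or, Option.some.injEq, exists_eq_left',
      List.mem_singleton, forall_eq]
    exact ⟨fun h => AlgSub.left h b, fun h => AlgSub.left h b.symm⟩

/-- A transition of the subtyping machine, whose state is a list of problems to solve, or `none`
after a negative answer. -/
def machineStep (s : Option (List Goal)) : Option (List Goal) :=
  s.bind fun gs => gs.head?.elim (some []) fun g => (nextGoals g).map (· ++ gs.tail)

theorem machineStep_iterate_none (n : ℕ) : machineStep^[n] none = none := by
  induction n with
  | zero => rfl
  | succ n ih => exact ih

theorem machineStep_iterate_nil (n : ℕ) : machineStep^[n] (some []) = some [] := by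
  induction n with
  | zero => rfl
  | succ n ih => exact ih

/-- The machine solves the problems `gs` at the front of its list, correctly. -/
def Solves (gs : List Goal) : Prop :=
  ∃ n, ((∀ g ∈ gs, Goal.Holds g) ∧ ∀ r, machineStep^[n] (some (gs ++ r)) = some r) ∨
    ((¬ ∀ g ∈ gs, Goal.Holds g) ∧ ∀ r, machineStep^[n] (some (gs ++ r)) = none)

/-- The quantification over the rest of the stack in `Solves` allows successive runs to be
concatenated. -/
theorem solves_of_forall {gs : List Goal} (h : ∀ g ∈ gs, Solves [g]) : Solves gs := by
  induction gs with
  | nil => exact ⟨0, .inl ⟨by simp, fun r => rfl⟩⟩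
  | cons g gs ih =>
    obtain ⟨m, hm⟩ := ih fun g' hg => h g' (List.mem_cons_of_mem g hg)
    obtain ⟨n, hn⟩ := h g List.mem_cons_self
    simp only [List.mem_singleton, forall_eq, List.singleton_append] at hn
    refine ⟨m + n, ?_⟩
    simp only [Function.iterate_add_apply, List.forall_mem_cons, List.cons_append]
    rcases hn with ⟨hg, hn⟩ | ⟨hg, hn⟩
    · rcases hm with ⟨hgs, hm⟩ | ⟨hgs, hm⟩
      · exact .inl ⟨⟨hg, hgs⟩, fun r => by rw [hn, hm]⟩
      · exact .inr ⟨fun h => hgs h.2, fun r => by rw [hn, hm]⟩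
    · exact .inr ⟨fun h => hg h.1, fun r => by rw [hn, machineStep_iterate_none]⟩

theorem solves_singleton {g : Goal}
    (h : Acc (Relation.TransGen (Sym2.GameAdd Smaller)) g.sides) : Solves [g] := by
  generalize hs : g.sides = s at h
  induction h generalizing g with
  | intro s _ ih =>
    subst hs
    have e (r : List Goal) :
        machineStep (some ([g] ++ r)) = (nextGoals g).map (· ++ r) := rfl
    have hg := nextGoals_holds g
    rcases hn : nextGoals g with _ | gs
    · refine ⟨1, .inr ⟨by simp [hg, hn], fun r => ?_⟩⟩
      rw [Function.iterate_one, e, hn]; rfl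
    · obtain ⟨n, h⟩ := solves_of_forall (gs := gs)
        fun g' hg' => ih _ (nextGoals_sides hn g' hg') rfl
      refine ⟨n + 1, ?_⟩
      simp only [Function.iterate_succ_apply, e, hn, List.mem_singleton, forall_eq, hg,
        Option.some.injEq, exists_eq_left', Option.map_some]
      exact h

/-- The answer in a final state of the machine. -/
def answer (s : Option (List Goal)) : Option Bool :=
  s.elim (some false) fun gs => if gs = [] then some true else none

theorem answer_eq_some {s : Option (List Goal)} {b : Bool} :
    answer s = some b ↔ (s = none ∧ b = false) ∨ (s = some [] ∧ b = true) := by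
  cases s with
  | none => simp [answer, eq_comm]
  | some gs => by_cases h : gs = [] <;> simp [answer, h, eq_comm]

/-- Both final states are fixed points of the machine, so an answer never changes once it is given.
-/
theorem answer_unique {s : Option (List Goal)} {m n : ℕ} {b c : Bool}
    (hb : answer (machineStep^[m] s) = some b) (hc : answer (machineStep^[n] s) = some c) :
    b = c := by
  wlog h : m ≤ n generalizing m n b c
  · exact (this hc hb (le_of_not_ge h)).symm
  obtain ⟨k, rfl⟩ := Nat.exists_eq_add_of_le' h
  rw [Function.iterate_add_apply] at hc
  rcases answer_eq_some.1 hb with ⟨e, rfl⟩ | ⟨e, rfl⟩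
  · rw [e, machineStep_iterate_none] at hc
    exact Option.some.inj hc
  · rw [e, machineStep_iterate_nil] at hc
    exact Option.some.inj hc

open Classical in
theorem exists_answer {g : Goal} (hA : Acc Smaller (g.1, g.2.1)) (hB : Acc Smaller (g.1, g.2.2)) :
    ∃ n, answer (machineStep^[n] (some [g])) = some (decide g.Holds) := by
  obtain ⟨n, h⟩ := solves_singleton (g := g) (Acc.sym2_gameAdd hA hB).transGen
  refine ⟨n, answer_eq_some.2 ?_⟩
  simp only [List.mem_singleton, forall_eq] at h
  rcases h with ⟨h, e⟩ | ⟨h, e⟩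
  · exact .inr ⟨e [], decide_eq_true h⟩
  · exact .inl ⟨e [], decide_eq_false h⟩

/-! ### Primitive recursive functions on types -/

section Primrec

/-- Case distinction on a type. -/
def Ty.elim {σ : Type} (v : ℕ → σ) (t : σ) (r : Ty × Ty → σ) (q : Knd × Ty × Ty → σ)
    (l : Knd × Ty → σ) (a : Ty × Ty → σ) : Ty → σ
  | .var n => v n
  | .top => t
  | .arrow A B => r (A, B)
  | .all K A B => q (K, A, B)
  | .lam K A => l (K, A)
  | .app A B => a (A, B)

theorem primrec_tyOfNat : Primrec Ty.ofNat :=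
  (Primrec.ofNat Ty).of_eq fun _ => rfl

theorem primrec_tyToNat : Primrec Ty.toNat := Primrec.encode

theorem primrec_kndOfNat : Primrec Knd.ofNat :=
  (Primrec.ofNat Knd).of_eq fun _ => rfl

theorem primrec_kndToNat : Primrec Knd.toNat := Primrec.encode

/-- Case distinction becomes arithmetic: the code minus one, modulo 5, identifies the constructor of
a type other than `top`. -/
theorem Ty.elim_eq {σ : Type} {v : ℕ → σ} {t : σ} {r : Ty × Ty → σ} {q : Knd × Ty × Ty → σ}
    {l : Knd × Ty → σ} {a : Ty × Ty → σ} (A : Ty) :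
    Ty.elim v t r q l a A =
      if A.toNat = 0 then t
      else if (A.toNat - 1) % 5 = 0 then v ((A.toNat - 1) / 5)
      else if (A.toNat - 1) % 5 = 1 then
        r (.ofNat ((A.toNat - 1) / 5).unpair.1, .ofNat ((A.toNat - 1) / 5).unpair.2)
      else if (A.toNat - 1) % 5 = 2 then
        a (.ofNat ((A.toNat - 1) / 5).unpair.1, .ofNat ((A.toNat - 1) / 5).unpair.2)
      else if (A.toNat - 1) % 5 = 3 then
        l (.ofNat ((A.toNat - 1) / 5).unpair.1, .ofNat ((A.toNat - 1) / 5).unpair.2)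
      else q (.ofNat ((A.toNat - 1) / 5).unpair.1,
        .ofNat ((A.toNat - 1) / 5).unpair.2.unpair.1,
        .ofNat ((A.toNat - 1) / 5).unpair.2.unpair.2) := by
  have hd (m r : ℕ) (hr : r < 5) : (5 * m + r) / 5 = m := by omega
  have hm (m r : ℕ) (hr : r < 5) : (5 * m + r) % 5 = r := by omega
  cases A <;> simp [Ty.elim, Ty.toNat, hd, hm, Ty.ofNat_toNat, Knd.ofNat_toNat]

variable {α σ P : Type} [Primcodable α] [Primcodable σ] [Primcodable P]

theorem _root_.Primrec.ty_elim {f : α → Ty} {v : α → ℕ → σ} {t : α → σ} {r : α → Ty × Ty → σ}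
    {q : α → Knd × Ty × Ty → σ} {l : α → Knd × Ty → σ} {a : α → Ty × Ty → σ} (hf : Primrec f)
    (hv : Primrec₂ v) (ht : Primrec t) (hr : Primrec₂ r) (hq : Primrec₂ q) (hl : Primrec₂ l)
    (ha : Primrec₂ a) :
    Primrec fun x => Ty.elim (v x) (t x) (r x) (q x) (l x) (a x) (f x) := by
  have hn : Primrec fun x => (f x).toNat := primrec_tyToNat.comp hf
  have hp : Primrec fun x => (f x).toNat - 1 := Primrec.nat_sub.comp hn (.const 1)
  have hm : Primrec fun x => ((f x).toNat - 1) % 5 := Primrec.nat_mod.comp hp (.const 5)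
  have hd : Primrec fun x => ((f x).toNat - 1) / 5 := Primrec.nat_div.comp hp (.const 5)
  have hu : Primrec fun x => (((f x).toNat - 1) / 5).unpair := Primrec.unpair.comp hd
  have h1 := Primrec.fst.comp hu
  have h2 := Primrec.snd.comp hu
  have hu' := Primrec.unpair.comp h2
  have eqc (c : ℕ) : PrimrecPred fun x => ((f x).toNat - 1) % 5 = c :=
    Primrec.eq.comp hm (.const c)
  refine (Primrec.ite (Primrec.eq.comp hn (.const 0)) ht <|
    Primrec.ite (eqc 0) (hv.comp .id hd) <|
    Primrec.ite (eqc 1)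
      (hr.comp .id ((primrec_tyOfNat.comp h1).pair (primrec_tyOfNat.comp h2))) <|
    Primrec.ite (eqc 2)
      (ha.comp .id ((primrec_tyOfNat.comp h1).pair (primrec_tyOfNat.comp h2))) <|
    Primrec.ite (eqc 3)
      (hl.comp .id ((primrec_kndOfNat.comp h1).pair (primrec_tyOfNat.comp h2))) <|
    hq.comp .id ((primrec_kndOfNat.comp h1).pair
      ((primrec_tyOfNat.comp (Primrec.fst.comp hu')).pair
        (primrec_tyOfNat.comp (Primrec.snd.comp hu'))))).of_eq fun x => (Ty.elim_eq (f x)).symm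

/-- Elimination of a list of length one. -/
def elimOne {σ τ : Type} (s : List σ) (f : σ → τ) : Option τ := s[0]?.map f

/-- Elimination of a list of length two. -/
def elimTwo {σ τ : Type} (s : List σ) (f : σ × σ → τ) : Option τ :=
  s[0]?.bind fun x => s[1]?.map fun y => f (x, y)

theorem primrec_elimOne {τ : Type} [Primcodable τ] {s : α → List σ} {f : α → σ → τ}
    (hs : Primrec s) (hf : Primrec₂ f) : Primrec fun a => elimOne (s a) (f a) :=
  Primrec.option_map (Primrec.list_getElem?.comp hs (.const 0)) hf

theorem primrec_elimTwo {τ : Type} [Primcodable τ] {s : α → List σ} {f : α → σ × σ → τ}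
    (hs : Primrec s) (hf : Primrec₂ f) : Primrec fun a => elimTwo (s a) (f a) :=
  Primrec.option_bind (Primrec.list_getElem?.comp hs (.const 0))
    (Primrec.option_map (Primrec.list_getElem?.comp (hs.comp .fst) (.const 1))
      (hf.comp (Primrec.fst.comp .fst) ((Primrec.snd.comp .fst).pair .snd)).to₂).to₂

/-- Structural recursion on types, with a parameter that changes under binders. -/
theorem _root_.Primrec.ty_rec {f : P → Ty → σ} {u : P → Knd → P} {v : P → ℕ → σ} {t : P → σ}
    {r : P × (Ty × Ty) → σ × σ → σ} {q : P × (Knd × Ty × Ty) → σ × σ → σ}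
    {l : P × (Knd × Ty) → σ → σ} {a : P × (Ty × Ty) → σ × σ → σ} (hu : Primrec₂ u)
    (hv : Primrec₂ v) (ht : Primrec t) (hr : Primrec₂ r) (hq : Primrec₂ q) (hl : Primrec₂ l)
    (ha : Primrec₂ a) (ev : ∀ p n, f p (.var n) = v p n) (et : ∀ p, f p .top = t p)
    (er : ∀ p A B, f p (.arrow A B) = r (p, A, B) (f p A, f p B))
    (eq : ∀ p K A B, f p (.all K A B) = q (p, K, A, B) (f p A, f (u p K) B))
    (el : ∀ p K A, f p (.lam K A) = l (p, K, A) (f (u p K) A))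
    (ea : ∀ p A B, f p (.app A B) = a (p, A, B) (f p A, f p B)) : Primrec₂ f := by
  -- Course-of-values recursion: `calls` lists the recursive calls, with the parameter changed under
  -- binders, and `combine` assembles their results.
  let calls (b : P × Ty) : List (P × Ty) :=
    Ty.elim (fun _ => []) [] (fun x => [(b.1, x.1), (b.1, x.2)])
      (fun x => [(b.1, x.2.1), (u b.1 x.1, x.2.2)]) (fun x => [(u b.1 x.1, x.2)])
      (fun x => [(b.1, x.1), (b.1, x.2)]) b.2
  let combine (b : P × Ty) (s : List σ) : Option σ :=
    Ty.elim (fun n => some (v b.1 n)) (some (t b.1)) (fun x => elimTwo s (r (b.1, x)))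
      (fun x => elimTwo s (q (b.1, x))) (fun x => elimOne s (l (b.1, x)))
      (fun x => elimTwo s (a (b.1, x))) b.2
  have pair_list {γ : Type} [Primcodable γ] {x y : γ → P × Ty} (hx : Primrec x)
      (hy : Primrec y) : Primrec fun c => [x c, y c] :=
    Primrec.list_cons.comp hx (Primrec.list_cons.comp hy (.const []))
  have hcalls : Primrec calls := by
    refine Primrec.ty_elim .snd (Primrec.const []).to₂ (.const []) ?_ ?_ ?_ ?_
    · exact (pair_list ((Primrec.fst.comp .fst).pair (Primrec.fst.comp .snd))
        ((Primrec.fst.comp .fst).pair (Primrec.snd.comp .snd))).to₂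
    · exact (pair_list
        ((Primrec.fst.comp .fst).pair (Primrec.fst.comp (Primrec.snd.comp .snd)))
        ((hu.comp (Primrec.fst.comp .fst) (Primrec.fst.comp .snd)).pair
          (Primrec.snd.comp (Primrec.snd.comp .snd)))).to₂
    · exact (Primrec.list_cons.comp ((hu.comp (Primrec.fst.comp .fst)
        (Primrec.fst.comp .snd)).pair (Primrec.snd.comp .snd)) (.const [])).to₂
    · exact (pair_list ((Primrec.fst.comp .fst).pair (Primrec.fst.comp .snd))
        ((Primrec.fst.comp .fst).pair (Primrec.snd.comp .snd))).to₂
  have hp {γ : Type} [Primcodable γ] : Primrec fun c : ((P × Ty) × List σ) × γ =>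
      (c.1.1.1, c.2) := (Primrec.fst.comp (Primrec.fst.comp .fst)).pair .snd
  have hs {γ : Type} [Primcodable γ] : Primrec fun c : ((P × Ty) × List σ) × γ => c.1.2 :=
    Primrec.snd.comp .fst
  have hcombine : Primrec₂ combine := by
    refine Primrec.ty_elim (Primrec.snd.comp .fst) ?_ ?_ ?_ ?_ ?_ ?_
    · exact (Primrec.option_some.comp (hv.comp (Primrec.fst.comp hp) .snd)).to₂
    · exact Primrec.option_some.comp (ht.comp (Primrec.fst.comp .fst))
    · exact (primrec_elimTwo hs (hr.comp (hp.comp .fst) .snd).to₂).to₂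
    · exact (primrec_elimTwo hs (hq.comp (hp.comp .fst) .snd).to₂).to₂
    · exact (primrec_elimOne hs (hl.comp (hp.comp .fst) .snd).to₂).to₂
    · exact (primrec_elimTwo hs (ha.comp (hp.comp .fst) .snd).to₂).to₂
  have left_lt (m n k : ℕ) (hk : 0 < k) : m < 5 * Nat.pair m n + k := by
    have := Nat.left_le_pair m n
    omega
  have right_lt (m n k : ℕ) (hk : 0 < k) : n < 5 * Nat.pair m n + k := by
    have := Nat.right_le_pair m n
    omega
  -- The Gödel number is the decreasing measure, since a component has a smaller code than the type.
  refine Primrec.nat_omega_rec' (fun b : P × Ty => f b.1 b.2) (m := fun b => b.2.toNat)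
    (primrec_tyToNat.comp .snd) hcalls hcombine ?_ ?_
  · rintro ⟨p, A⟩ b hb
    cases A with
    | var n => cases hb
    | top => cases hb
    | arrow A B =>
      simp only [calls, Ty.elim, List.mem_cons, List.not_mem_nil, or_false] at hb
      rcases hb with rfl | rfl
      · exact left_lt _ _ _ (by decide)
      · exact right_lt _ _ _ (by decide)
    | all K A B =>
      simp only [calls, Ty.elim, List.mem_cons, List.not_mem_nil, or_false] at hb
      rcases hb with rfl | rfl
      · exact (Nat.left_le_pair _ _).trans_lt (right_lt _ _ _ (by decide))
      · exact (Nat.right_le_pair _ _).trans_lt (right_lt _ _ _ (by decide))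
    | lam K A =>
      simp only [calls, Ty.elim, List.mem_cons, List.not_mem_nil, or_false] at hb
      subst hb
      exact right_lt _ _ _ (by decide)
    | app A B =>
      simp only [calls, Ty.elim, List.mem_cons, List.not_mem_nil, or_false] at hb
      rcases hb with rfl | rfl
      · exact left_lt _ _ _ (by decide)
      · exact right_lt _ _ _ (by decide)
  · rintro ⟨p, A⟩
    cases A <;> simp [calls, combine, Ty.elim, elimOne, elimTwo, ev, et, er, eq, el, ea]

/-! ### Primitive recursive constructors -/

theorem primrec_var : Primrec Ty.var :=
  Primrec.encode_iff.1 (Primrec.nat_add.comp (Primrec.nat_mul.comp (.const 5) .id) (.const 1))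

theorem primrec_arrow : Primrec₂ Ty.arrow :=
  Primrec₂.encode_iff.1 (Primrec.nat_add.comp (Primrec.nat_mul.comp (.const 5)
    (Primrec₂.natPair.comp (primrec_tyToNat.comp .fst) (primrec_tyToNat.comp .snd))) (.const 2)).to₂

theorem primrec_app : Primrec₂ Ty.app :=
  Primrec₂.encode_iff.1 (Primrec.nat_add.comp (Primrec.nat_mul.comp (.const 5)
    (Primrec₂.natPair.comp (primrec_tyToNat.comp .fst) (primrec_tyToNat.comp .snd))) (.const 3)).to₂

theorem primrec_lam : Primrec₂ Ty.lam :=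
  Primrec₂.encode_iff.1 (Primrec.nat_add.comp (Primrec.nat_mul.comp (.const 5)
    (Primrec₂.natPair.comp (primrec_kndToNat.comp .fst) (primrec_tyToNat.comp .snd)))
    (.const 4)).to₂

theorem primrec_all : Primrec fun p : Knd × Ty × Ty => Ty.all p.1 p.2.1 p.2.2 :=
  Primrec.encode_iff.1 (Primrec.nat_add.comp (Primrec.nat_mul.comp (.const 5)
    (Primrec₂.natPair.comp (primrec_kndToNat.comp .fst)
      (Primrec₂.natPair.comp (primrec_tyToNat.comp (Primrec.fst.comp .snd))
        (primrec_tyToNat.comp (Primrec.snd.comp .snd))))) (.const 5))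

theorem primrec_arr : Primrec₂ Knd.arr :=
  Primrec₂.encode_iff.1 (Primrec.succ.comp
    (Primrec₂.natPair.comp (primrec_kndToNat.comp .fst) (primrec_kndToNat.comp .snd))).to₂

end Primrec

/-! ### Primitive recursiveness of substitution, reduction and the subtyping machine. -/

section Primrec

variable {α σ : Type} [Primcodable α] [Primcodable σ]

/-- Structural recursion on types, with a fixed parameter. -/
theorem _root_.Primrec.ty_rec' {P : Type} [Primcodable P] {f : P → Ty → σ} {v : P → ℕ → σ}
    {t : P → σ} {r : P × (Ty × Ty) → σ × σ → σ} {q : P × (Knd × Ty × Ty) → σ × σ → σ}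
    {l : P × (Knd × Ty) → σ → σ} {a : P × (Ty × Ty) → σ × σ → σ}
    (hv : Primrec₂ v) (ht : Primrec t) (hr : Primrec₂ r) (hq : Primrec₂ q) (hl : Primrec₂ l)
    (ha : Primrec₂ a) (ev : ∀ p n, f p (.var n) = v p n) (et : ∀ p, f p .top = t p)
    (er : ∀ p A B, f p (.arrow A B) = r (p, A, B) (f p A, f p B))
    (eq : ∀ p K A B, f p (.all K A B) = q (p, K, A, B) (f p A, f p B))
    (el : ∀ p K A, f p (.lam K A) = l (p, K, A) (f p A))
    (ea : ∀ p A B, f p (.app A B) = a (p, A, B) (f p A, f p B)) : Primrec₂ f :=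
  Primrec.ty_rec (u := fun p _ => p) Primrec₂.left hv ht hr hq hl ha ev et er eq el ea

/-- A function on types that commutes with all constructors but variables, with a parameter that
changes under binders, is primitive recursive if it is so on variables. -/
theorem primrec_of_congr {P : Type} [Primcodable P] {f : P → Ty → Ty} {u : P → P}
    (hu : Primrec u) (hv : Primrec₂ fun p n => f p (.var n)) (et : ∀ p, f p .top = .top)
    (er : ∀ p A B, f p (.arrow A B) = .arrow (f p A) (f p B))
    (eq : ∀ p K A B, f p (.all K A B) = .all K (f p A) (f (u p) B))
    (el : ∀ p K A, f p (.lam K A) = .lam K (f (u p) A))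
    (ea : ∀ p A B, f p (.app A B) = .app (f p A) (f p B)) : Primrec₂ f := by
  refine Primrec.ty_rec (u := fun p _ => u p) (t := fun _ => .top)
    (r := fun _ y => .arrow y.1 y.2) (q := fun x y => .all x.2.1 y.1 y.2)
    (l := fun x y => .lam x.2.1 y) (a := fun _ y => .app y.1 y.2)
    (hu.comp .fst).to₂ hv (.const _) ?_ ?_ ?_ ?_ (fun _ _ => rfl) et er eq el ea
  · exact (primrec_arrow.comp (Primrec.fst.comp .snd) (Primrec.snd.comp .snd)).to₂
  · exact (primrec_all.comp ((Primrec.fst.comp (Primrec.snd.comp .fst)).pair .snd)).to₂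
  · exact (primrec_lam.comp (Primrec.fst.comp (Primrec.snd.comp .fst)) .snd).to₂
  · exact (primrec_app.comp (Primrec.fst.comp .snd) (Primrec.snd.comp .snd)).to₂

/-- A renaming is a function and has no code. The renamings met while shifting depend only on the
number of binders crossed, which serves as the recursion parameter. -/
theorem upRen_iterate_succ (c n : ℕ) :
    upRen^[c] Nat.succ n = if n < c then n else n + 1 := by
  induction c generalizing n with
  | zero => rfl
  | succ c ih =>
    rw [Function.iterate_succ_apply']
    cases n with
    | zero => simp [upRen]
    | succ n =>
      simp only [upRen, ih, Nat.add_lt_add_iff_right]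
      split_ifs <;> rfl

theorem primrec_shift : Primrec Ty.shift := by
  have : Primrec₂ fun (c : ℕ) (A : Ty) => A.rename (upRen^[c] Nat.succ) := by
    refine primrec_of_congr .succ ?_ (fun _ => rfl) (fun _ _ _ => rfl) ?_ ?_ (fun _ _ _ => rfl)
    · simp only [Ty.rename, upRen_iterate_succ]
      exact (primrec_var.comp (Primrec.ite (Primrec.nat_lt.comp .snd .fst) .snd
        (Primrec.succ.comp .snd))).to₂
    · intro c K A B
      simp only [Ty.rename, Function.iterate_succ_apply']
    · intro c K A
      simp only [Ty.rename, Function.iterate_succ_apply']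
  exact this.comp (.const 0) .id

/-- As for renamings: the binder depth and the substituted type determine the substitution. -/
theorem upSubst_iterate_single (c : ℕ) (B : Ty) (n : ℕ) :
    Ty.upSubst^[c] (Ty.single B) n =
      if n < c then .var n else if n = c then Ty.shift^[c] B else .var (n - 1) := by
  induction c generalizing n with
  | zero => cases n <;> simp [Ty.single]
  | succ c ih =>
    rw [Function.iterate_succ_apply']
    cases n with
    | zero => simp [Ty.upSubst]
    | succ n =>
      simp only [Ty.upSubst, ih, Nat.add_lt_add_iff_right, Nat.add_right_cancel_iff,
        Function.iterate_succ_apply']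
      split_ifs with h h'
      · rfl
      · rfl
      · simp only [Ty.shift, Ty.rename]
        congr 1
        omega

theorem primrec_inst : Primrec₂ Ty.inst := by
  have : Primrec₂ fun (p : ℕ × Ty) (A : Ty) => A.subst (Ty.upSubst^[p.1] (Ty.single p.2)) := by
    refine primrec_of_congr ((Primrec.succ.comp .fst).pair .snd) ?_ (fun _ => rfl)
      (fun _ _ _ => rfl) ?_ ?_ (fun _ _ _ => rfl)
    · simp only [Ty.subst, upSubst_iterate_single]
      have hc : Primrec fun a : (ℕ × Ty) × ℕ => a.1.1 := Primrec.fst.comp .fst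
      exact (Primrec.ite (Primrec.nat_lt.comp .snd hc) (primrec_var.comp .snd) <|
        Primrec.ite (Primrec.eq.comp .snd hc)
          (Primrec.nat_iterate hc (Primrec.snd.comp .fst) (primrec_shift.comp .snd).to₂) <|
        primrec_var.comp (Primrec.nat_sub.comp .snd (.const 1))).to₂
    · intro c K A B
      simp only [Ty.subst, Function.iterate_succ_apply']
    · intro c K A
      simp only [Ty.subst, Function.iterate_succ_apply']
  exact (this.comp ((Primrec.const 0).pair .snd) .fst).to₂

theorem bound_eq (D : Bounds) (n : ℕ) :
    bound D n = (D[n]?.bind id).map (Ty.shift^[n + 1]) := by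
  induction D generalizing n with
  | nil => rfl
  | cons o D ih =>
    cases n with
    | zero => rfl
    | succ n =>
      simp only [bound, ih, List.getElem?_cons_succ, Option.map_map, Function.iterate_succ']

theorem primrec_bound : Primrec₂ bound := by
  have : Primrec₂ fun (D : Bounds) (n : ℕ) => (D[n]?.bind id).map (Ty.shift^[n + 1]) :=
    (Primrec.option_map (Primrec.option_bind Primrec.list_getElem? Primrec₂.right)
      (Primrec.nat_iterate (Primrec.succ.comp (Primrec.snd.comp .fst)) .snd
        (primrec_shift.comp .snd).to₂).to₂).to₂
  exact this.of_eq fun D n => (bound_eq D n).symm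

theorem primrec_asArrow : Primrec Ty.asArrow :=
  (Primrec.ty_elim (f := fun A : Ty => A) (v := fun _ _ => none) (t := fun _ => none)
    (r := fun _ p => some p) (q := fun _ _ => none) (l := fun _ _ => none) (a := fun _ _ => none)
    .id (Primrec.const _).to₂ (.const _) (Primrec.option_some.comp .snd).to₂
    (Primrec.const _).to₂ (Primrec.const _).to₂ (Primrec.const _).to₂).of_eq
    fun A => by cases A <;> rfl

theorem primrec_asAll : Primrec Ty.asAll :=
  (Primrec.ty_elim (f := fun A : Ty => A) (v := fun _ _ => none) (t := fun _ => none)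
    (r := fun _ _ => none) (q := fun _ p => some p) (l := fun _ _ => none) (a := fun _ _ => none)
    .id (Primrec.const _).to₂ (.const _) (Primrec.const _).to₂
    (Primrec.option_some.comp .snd).to₂ (Primrec.const _).to₂ (Primrec.const _).to₂).of_eq
    fun A => by cases A <;> rfl

theorem primrec_asLam : Primrec Ty.asLam :=
  (Primrec.ty_elim (f := fun A : Ty => A) (v := fun _ _ => none) (t := fun _ => none)
    (r := fun _ _ => none) (q := fun _ _ => none) (l := fun _ p => some p) (a := fun _ _ => none)
    .id (Primrec.const _).to₂ (.const _) (Primrec.const _).to₂ (Primrec.const _).to₂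
    (Primrec.option_some.comp .snd).to₂ (Primrec.const _).to₂).of_eq
    fun A => by cases A <;> rfl

theorem primrec_isTop : Primrec Ty.isTop :=
  (Primrec.ty_rec' (P := Unit) (f := fun _ A => A.isTop) (v := fun _ _ => false)
    (t := fun _ => true) (r := fun _ _ => false) (q := fun _ _ => false) (l := fun _ b => b)
    (a := fun _ _ => false) (Primrec.const _).to₂ (.const _) (Primrec.const _).to₂
    (Primrec.const _).to₂ Primrec.snd.to₂ (Primrec.const _).to₂ (fun _ _ => rfl) (fun _ => rfl)
    (fun _ _ _ => rfl) (fun _ _ _ _ => rfl) (fun _ _ _ => rfl) (fun _ _ _ => rfl)).comp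
    (.const ()) .id

theorem primrec_promoteHead : Primrec₂ promoteHead :=
  Primrec.ty_rec' (v := bound) (t := fun _ => none) (r := fun _ _ => none) (q := fun _ _ => none)
    (l := fun _ _ => none) (a := fun x y => y.1.map (Ty.app · x.2.2))
    primrec_bound (.const _) (Primrec.const _).to₂ (Primrec.const _).to₂ (Primrec.const _).to₂
    (Primrec.option_map (Primrec.fst.comp .snd)
      (primrec_app.comp .snd (Primrec.snd.comp (Primrec.snd.comp (Primrec.fst.comp .fst)))).to₂).to₂
    (fun _ _ => rfl) (fun _ => rfl)
    (fun _ _ _ => rfl) (fun _ _ _ _ => rfl) (fun _ _ _ => rfl) (fun _ _ _ => rfl)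

theorem primrec_reduceStep : Primrec reduceStep := by
  have : Primrec₂ fun (_ : Unit) A => reduceStep A := by
    refine Primrec.ty_rec' (v := fun _ _ => none) (t := fun _ => none)
      (r := fun x y => y.1.map (Ty.arrow · x.2.2) <|> y.2.map (Ty.arrow x.2.1))
      (q := fun x y => y.1.map (Ty.all x.2.1 · x.2.2.2) <|> y.2.map (Ty.all x.2.1 x.2.2.1))
      (l := fun x y => y.map (Ty.lam x.2.1))
      (a := fun x y => x.2.1.asLam.map (fun p => p.2.inst x.2.2) <|>
        (y.1.map (Ty.app · x.2.2) <|> y.2.map (Ty.app x.2.1)))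
      (Primrec.const _).to₂ (.const _) ?_ ?_ ?_ ?_ (fun _ _ => rfl) (fun _ => rfl)
      (fun _ _ _ => rfl) (fun _ _ _ _ => rfl) (fun _ _ _ => rfl) (fun _ _ _ => rfl)
    · have h₁ : Primrec fun c : (Unit × (Ty × Ty)) × (Option Ty × Option Ty) =>
          c.2.1.map (Ty.arrow · c.1.2.2) :=
        Primrec.option_map (Primrec.fst.comp .snd) (primrec_arrow.comp .snd
          (Primrec.snd.comp (Primrec.snd.comp (Primrec.fst.comp .fst)))).to₂
      have h₂ : Primrec fun c : (Unit × (Ty × Ty)) × (Option Ty × Option Ty) =>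
          c.2.2.map (Ty.arrow c.1.2.1) :=
        Primrec.option_map (Primrec.snd.comp .snd) (primrec_arrow.comp
          (Primrec.fst.comp (Primrec.snd.comp (Primrec.fst.comp .fst))) .snd).to₂
      exact (Primrec.option_orElse.comp h₁ h₂).to₂
    · have hK : Primrec fun c : ((Unit × (Knd × Ty × Ty)) × (Option Ty × Option Ty)) × Ty =>
          c.1.1.2 := Primrec.snd.comp (Primrec.fst.comp .fst)
      have h₁ : Primrec fun c : (Unit × (Knd × Ty × Ty)) × (Option Ty × Option Ty) =>
          c.2.1.map (Ty.all c.1.2.1 · c.1.2.2.2) :=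
        Primrec.option_map (Primrec.fst.comp .snd) (primrec_all.comp ((Primrec.fst.comp hK).pair
          (Primrec.snd.pair (Primrec.snd.comp (Primrec.snd.comp hK))))).to₂
      have h₂ : Primrec fun c : (Unit × (Knd × Ty × Ty)) × (Option Ty × Option Ty) =>
          c.2.2.map (Ty.all c.1.2.1 c.1.2.2.1) :=
        Primrec.option_map (Primrec.snd.comp .snd) (primrec_all.comp ((Primrec.fst.comp hK).pair
          ((Primrec.fst.comp (Primrec.snd.comp hK)).pair .snd))).to₂
      exact (Primrec.option_orElse.comp h₁ h₂).to₂
    · exact (Primrec.option_map .snd (primrec_lam.comp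
        (Primrec.fst.comp (Primrec.snd.comp (Primrec.fst.comp .fst))) .snd).to₂).to₂
    · have h₁ : Primrec fun c : (Unit × (Ty × Ty)) × (Option Ty × Option Ty) =>
          c.1.2.1.asLam.map (fun p => p.2.inst c.1.2.2) :=
        Primrec.option_map (primrec_asLam.comp (Primrec.fst.comp (Primrec.snd.comp .fst)))
          (primrec_inst.comp (Primrec.snd.comp .snd)
            (Primrec.snd.comp (Primrec.snd.comp (Primrec.fst.comp .fst)))).to₂
      have h₂ : Primrec fun c : (Unit × (Ty × Ty)) × (Option Ty × Option Ty) =>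
          c.2.1.map (Ty.app · c.1.2.2) :=
        Primrec.option_map (Primrec.fst.comp .snd) (primrec_app.comp .snd
          (Primrec.snd.comp (Primrec.snd.comp (Primrec.fst.comp .fst)))).to₂
      have h₃ : Primrec fun c : (Unit × (Ty × Ty)) × (Option Ty × Option Ty) =>
          c.2.2.map (Ty.app c.1.2.1) :=
        Primrec.option_map (Primrec.snd.comp .snd) (primrec_app.comp
          (Primrec.fst.comp (Primrec.snd.comp (Primrec.fst.comp .fst))) .snd).to₂
      exact (Primrec.option_orElse.comp h₁ (Primrec.option_orElse.comp h₂ h₃)).to₂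
  exact this.comp (.const ()) .id

theorem primrec_compareHeads : Primrec compareHeads := by
  have single {γ β : Type} [Primcodable γ] [Primcodable β] {x : γ → β} (hx : Primrec x) :
      Primrec fun c => [x c] := Primrec.list_cons.comp hx (.const [])
  have hA : Primrec fun g : Goal => g.2.1 := Primrec.fst.comp .snd
  have hB : Primrec fun g : Goal => g.2.2 := Primrec.snd.comp .snd
  have h₁ : Primrec fun g : Goal => g.2.1.asArrow.bind fun a => g.2.2.asArrow.map fun b =>
      ([(g.1, b.1, a.1), (g.1, a.2, b.2)] : List Goal) := by
    have hD : Primrec fun c : (Goal × (Ty × Ty)) × (Ty × Ty) => c.1.1.1 :=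
      Primrec.fst.comp (Primrec.fst.comp .fst)
    have ha : Primrec fun c : (Goal × (Ty × Ty)) × (Ty × Ty) => c.1.2 := Primrec.snd.comp .fst
    exact Primrec.option_bind (primrec_asArrow.comp hA)
      (Primrec.option_map (primrec_asArrow.comp (hB.comp .fst)) (Primrec.list_cons.comp
        (hD.pair ((Primrec.fst.comp .snd).pair (Primrec.fst.comp ha)))
        (single (hD.pair ((Primrec.snd.comp ha).pair (Primrec.snd.comp .snd))))).to₂).to₂
  have h₂ : Primrec fun g : Goal => g.2.1.asAll.bind fun a => g.2.2.asAll.bind fun b =>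
      if a.1 = b.1 ∧ a.2.1 = b.2.1 then some ([(some a.2.1 :: g.1, a.2.2, b.2.2)] : List Goal)
      else none := by
    have hD : Primrec fun c : (Goal × (Knd × Ty × Ty)) × (Knd × Ty × Ty) => c.1.1.1 :=
      Primrec.fst.comp (Primrec.fst.comp .fst)
    have ha : Primrec fun c : (Goal × (Knd × Ty × Ty)) × (Knd × Ty × Ty) => c.1.2 :=
      Primrec.snd.comp .fst
    have hb : Primrec fun c : (Goal × (Knd × Ty × Ty)) × (Knd × Ty × Ty) => c.2 := .snd
    have ha' := Primrec.fst.comp (Primrec.snd.comp ha)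
    exact Primrec.option_bind (primrec_asAll.comp hA)
      (Primrec.option_bind (primrec_asAll.comp (hB.comp .fst))
        (Primrec.ite (.and (Primrec.eq.comp (Primrec.fst.comp ha) (Primrec.fst.comp hb))
          (Primrec.eq.comp ha' (Primrec.fst.comp (Primrec.snd.comp hb))))
          (Primrec.option_some.comp (single
            ((Primrec.list_cons.comp (Primrec.option_some.comp ha') hD).pair
              ((Primrec.snd.comp (Primrec.snd.comp ha)).pair
                (Primrec.snd.comp (Primrec.snd.comp hb)))))) (.const none)).to₂).to₂
  have h₃ : Primrec fun g : Goal => g.2.1.asLam.bind fun a => g.2.2.asLam.bind fun b =>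
      if a.1 = b.1 then some ([(none :: g.1, a.2, b.2)] : List Goal) else none := by
    have hD : Primrec fun c : (Goal × (Knd × Ty)) × (Knd × Ty) => c.1.1.1 :=
      Primrec.fst.comp (Primrec.fst.comp .fst)
    have ha : Primrec fun c : (Goal × (Knd × Ty)) × (Knd × Ty) => c.1.2 := Primrec.snd.comp .fst
    have hb : Primrec fun c : (Goal × (Knd × Ty)) × (Knd × Ty) => c.2 := .snd
    exact Primrec.option_bind (primrec_asLam.comp hA)
      (Primrec.option_bind (primrec_asLam.comp (hB.comp .fst))
        (Primrec.ite (Primrec.eq.comp (Primrec.fst.comp ha) (Primrec.fst.comp hb))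
          (Primrec.option_some.comp (single ((Primrec.list_cons.comp (.const none) hD).pair
            ((Primrec.snd.comp ha).pair (Primrec.snd.comp hb))))) (.const none)).to₂).to₂
  exact Primrec.option_orElse.comp h₁ (Primrec.option_orElse.comp h₂ h₃)

theorem primrec_nextGoals : Primrec nextGoals := by
  have single {γ β : Type} [Primcodable γ] [Primcodable β] {x : γ → β} (hx : Primrec x) :
      Primrec fun c => [x c] := Primrec.list_cons.comp hx (.const [])
  have hA : Primrec fun g : Goal => g.2.1 := Primrec.fst.comp .snd
  have hB : Primrec fun g : Goal => g.2.2 := Primrec.snd.comp .snd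
  have hl : Primrec₂ fun (g : Goal) (A : Ty) => ([(g.1, A, g.2.2)] : List Goal) :=
    (single ((Primrec.fst.comp .fst).pair (Primrec.snd.pair (hB.comp .fst)))).to₂
  have hr : Primrec₂ fun (g : Goal) (B : Ty) => ([(g.1, g.2.1, B)] : List Goal) :=
    (single ((Primrec.fst.comp .fst).pair ((hA.comp .fst).pair .snd))).to₂
  refine Primrec.option_orElse.comp (Primrec.option_map (primrec_reduceStep.comp hA) hl)
    (Primrec.option_orElse.comp (Primrec.option_map (primrec_reduceStep.comp hB) hr)
      (Primrec.ite (.or ?_ (Primrec.eq.comp hA hB)) (.const _) (Primrec.option_orElse.comp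
        (Primrec.option_map (primrec_promoteHead.comp .fst hA) hl) primrec_compareHeads)))
  exact Primrec.eq.comp (primrec_isTop.comp hB) (.const true)

theorem primrec_machineStep : Primrec machineStep := by
  have h : Primrec fun gs : List Goal =>
      gs.head?.elim (some []) fun g => (nextGoals g).map (· ++ gs.tail) :=
    (Primrec.option_casesOn Primrec.list_head? (.const (some []))
      (Primrec.option_map (primrec_nextGoals.comp .snd) (Primrec.list_append.comp .snd
        (Primrec.list_tail.comp (Primrec.fst.comp .fst))).to₂).to₂).of_eq
      fun gs => by cases gs <;> rfl
  exact Primrec.option_bind .id (h.comp .snd).to₂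

theorem primrec_answer : Primrec answer := by
  refine (Primrec.option_casesOn .id (.const (some false))
    (Primrec.ite (Primrec.eq.comp .snd (.const [])) (.const (some true)) (.const none)).to₂).of_eq
    fun s => ?_
  cases s <;> rfl

/-! ### Decidability -/

/-- The domain and codomain of an arrow kind. -/
def Knd.asArr : Knd → Option (Knd × Knd)
  | .star => none
  | .arr K K' => some (K, K')

theorem primrec_asArr : Primrec Knd.asArr := by
  have hu : Primrec fun K : Knd => (K.toNat - 1).unpair :=
    Primrec.unpair.comp (Primrec.nat_sub.comp primrec_kndToNat (.const 1))
  refine (Primrec.ite (Primrec.eq.comp primrec_kndToNat (.const 0)) (.const none)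
    (Primrec.option_some.comp ((primrec_kndOfNat.comp (Primrec.fst.comp hu)).pair
      (primrec_kndOfNat.comp (Primrec.snd.comp hu))))).of_eq fun K => ?_
  cases K <;> simp [Knd.asArr, Knd.toNat, Knd.ofNat_toNat]

/-- The kind of a type, if it has one. -/
def inferKind : List Knd → Ty → Option Knd
  | Δ, .var n => Δ[n]?
  | _, .top => some .star
  | Δ, .arrow A B =>
    if inferKind Δ A = some .star ∧ inferKind Δ B = some .star then some .star else none
  | Δ, .all K A B =>
    if inferKind Δ A = some K ∧ inferKind (K :: Δ) B = some .star then some .star else none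
  | Δ, .lam K A => (inferKind (K :: Δ) A).map (Knd.arr K)
  | Δ, .app A B => ((inferKind Δ A).bind Knd.asArr).bind fun p =>
      if inferKind Δ B = some p.1 then some p.2 else none

theorem inferKind_eq_some {Δ : List Knd} {A : Ty} {K : Knd} :
    inferKind Δ A = some K ↔ Kinded Δ A K := by
  constructor
  · intro h
    induction A generalizing Δ K with
    | var n => exact .var h
    | top => cases h; exact .top
    | arrow A B ihA ihB =>
      simp only [inferKind, Option.ite_none_right_eq_some, Option.some.injEq] at h
      obtain ⟨⟨hA, hB⟩, rfl⟩ := h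
      exact .arrow (ihA hA) (ihB hB)
    | all K A B ihA ihB =>
      simp only [inferKind, Option.ite_none_right_eq_some, Option.some.injEq] at h
      obtain ⟨⟨hA, hB⟩, rfl⟩ := h
      exact .all (ihA hA) (ihB hB)
    | lam K A ih =>
      obtain ⟨K', hA, rfl⟩ := Option.map_eq_some_iff.1 h
      exact .lam (ih hA)
    | app A B ihA ihB =>
      simp only [inferKind, Option.bind_eq_some_iff, Option.ite_none_right_eq_some,
        Option.some.injEq] at h
      obtain ⟨p, ⟨K', hA, hp⟩, hB, rfl⟩ := h
      cases K' with
      | star => cases hp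
      | arr K₁ K₂ =>
        cases hp
        exact .app (ihA hA) (ihB hB)
  · intro h
    induction h with
    | var h => exact h
    | top => rfl
    | arrow _ _ hA hB => simp [inferKind, hA, hB]
    | all _ _ hA hB => simp [inferKind, hA, hB]
    | lam _ hA => simp [inferKind, hA]
    | app _ _ hA hB => simp [inferKind, hA, hB, Knd.asArr]

theorem primrec_inferKind : Primrec₂ inferKind := by
  have isSome_eq {γ : Type} [Primcodable γ] {x : γ → Option Knd} {y : γ → Knd} (hx : Primrec x)
      (hy : Primrec y) : PrimrecPred fun c => x c = some (y c) :=
    Primrec.eq.comp hx (Primrec.option_some.comp hy)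
  refine Primrec.ty_rec (u := fun Δ K => K :: Δ) (v := fun Δ n => Δ[n]?)
    (t := fun _ => some .star)
    (r := fun _ y => if y.1 = some .star ∧ y.2 = some .star then some .star else none)
    (q := fun x y => if y.1 = some x.2.1 ∧ y.2 = some .star then some .star else none)
    (l := fun x y => y.map (Knd.arr x.2.1))
    (a := fun _ y => (y.1.bind Knd.asArr).bind fun p => if y.2 = some p.1 then some p.2 else none)
    (Primrec.list_cons.comp .snd .fst).to₂ Primrec.list_getElem? (.const _) ?_ ?_ ?_ ?_
    (fun _ _ => rfl) (fun _ => rfl)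
    (fun _ _ _ => rfl) (fun _ _ _ _ => rfl) (fun _ _ _ => rfl) (fun _ _ _ => rfl)
  · exact (Primrec.ite (.and
      (isSome_eq (Primrec.fst.comp .snd) (.const Knd.star))
      (isSome_eq (Primrec.snd.comp .snd) (.const Knd.star))) (.const _) (.const _)).to₂
  · exact (Primrec.ite (.and
      (isSome_eq (Primrec.fst.comp .snd) (Primrec.fst.comp (Primrec.snd.comp .fst)))
      (isSome_eq (Primrec.snd.comp .snd) (.const Knd.star))) (.const _) (.const _)).to₂
  · exact (Primrec.option_map .snd (primrec_arr.comp
      (Primrec.fst.comp (Primrec.snd.comp (Primrec.fst.comp .fst))) .snd).to₂).to₂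
  · exact (Primrec.option_bind
      (Primrec.option_bind (Primrec.fst.comp .snd) (primrec_asArr.comp .snd).to₂)
      (Primrec.ite (isSome_eq (Primrec.snd.comp (Primrec.snd.comp .fst)) (Primrec.fst.comp .snd))
        (Primrec.option_some.comp (Primrec.snd.comp .snd)) (.const none)).to₂).to₂

theorem primrec_kinds : Primrec fun Γ : Ctx => Γ.map Prod.snd :=
  Primrec.list_map .id (Primrec.snd.comp .snd).to₂

/-- The decision procedure for well-formedness of contexts. -/
def checkCtx : Ctx → Bool
  | [] => true
  | d :: Γ => checkCtx Γ && decide (inferKind (Γ.map Prod.snd) d.1 = some d.2)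

theorem checkCtx_iff {Γ : Ctx} : checkCtx Γ = true ↔ WellFormed Γ := by
  induction Γ with
  | nil => simp [checkCtx, WellFormed]
  | cons d Γ ih => simp [checkCtx, WellFormed, ih, inferKind_eq_some]

theorem primrec_checkCtx : Primrec checkCtx := by
  have h : Primrec₂ fun (_ : Ctx) (p : (Ty × Knd) × Ctx × Bool) =>
      p.2.2 && decide (inferKind (p.2.1.map Prod.snd) p.1.1 = some p.1.2) := by
    have hp : Primrec fun c : Ctx × (Ty × Knd) × Ctx × Bool => c.2 := .snd
    have he : PrimrecPred fun c : Ctx × (Ty × Knd) × Ctx × Bool =>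
        inferKind (c.2.2.1.map Prod.snd) c.2.1.1 = some c.2.1.2 :=
      Primrec.eq.comp
        (primrec_inferKind.comp (primrec_kinds.comp (Primrec.fst.comp (Primrec.snd.comp hp)))
          (Primrec.fst.comp (Primrec.fst.comp hp)))
        (Primrec.option_some.comp (Primrec.snd.comp (Primrec.fst.comp hp)))
    exact (Primrec.and.comp (Primrec.snd.comp (Primrec.snd.comp hp)) he.decide).to₂
  refine (Primrec.list_rec .id (.const true) h).of_eq fun Γ => ?_
  induction Γ with
  | nil => rfl
  | cons d Γ ih => simp only [checkCtx, ← ih]; rfl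

theorem primrecPred_hasKind :
    PrimrecPred fun p : Ctx × Ty × Knd => HasKind p.1 p.2.1 p.2.2 := by
  refine ((Primrec.eq.comp (primrec_checkCtx.comp .fst) (.const true)).and
    (Primrec.eq.comp (primrec_inferKind.comp (primrec_kinds.comp .fst)
      (Primrec.fst.comp .snd)) (Primrec.option_some.comp (Primrec.snd.comp .snd)))).of_eq
    fun p => ?_
  rw [hasKind_iff, checkCtx_iff, inferKind_eq_some]

end Primrec

/-! ### Decidability of subtyping. -/

open Classical in
theorem computablePred_subAt :
    ComputablePred fun p : Ctx × Ty × Ty × Knd => SubAt p.1 p.2.1 p.2.2.1 p.2.2.2 := by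
  let goal (p : Ctx × Ty × Ty × Knd) : Goal := (p.1.map fun d => some d.1, p.2.1, p.2.2.1)
  let kinded (p : Ctx × Ty × Ty × Knd) : Prop :=
    HasKind p.1 p.2.1 p.2.2.2 ∧ HasKind p.1 p.2.2.1 p.2.2.2
  -- Ill-kinded problems are rejected before the machine starts, because on types without normal
  -- form it need not halt.
  let run (p : Ctx × Ty × Ty × Knd) (n : ℕ) : Option Bool :=
    if kinded p then answer (machineStep^[n] (some [goal p])) else some false
  have hk : PrimrecPred kinded :=
    (primrecPred_hasKind.comp (Primrec.fst.pair
      ((Primrec.fst.comp .snd).pair (Primrec.snd.comp (Primrec.snd.comp .snd))))).and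
    (primrecPred_hasKind.comp (Primrec.fst.pair
      ((Primrec.fst.comp (Primrec.snd.comp .snd)).pair
        (Primrec.snd.comp (Primrec.snd.comp .snd)))))
  have hgoal : Primrec goal :=
    (Primrec.list_map .fst (Primrec.option_some.comp (Primrec.fst.comp .snd)).to₂).pair
      ((Primrec.fst.comp .snd).pair (Primrec.fst.comp (Primrec.snd.comp .snd)))
  have hrun : Primrec₂ run :=
    (Primrec.ite (hk.comp .fst) (primrec_answer.comp (Primrec.nat_iterate .snd
      (Primrec.option_some.comp (Primrec.list_cons.comp (hgoal.comp .fst) (.const [])))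
      (primrec_machineStep.comp .snd).to₂)) (.const (some false))).to₂
  refine ⟨fun p => inferInstance, ?_⟩
  refine (Partrec.rfindOpt hrun.to_comp).of_eq fun p => ?_
  have total : ∃ n, run p n = some (decide (SubAt p.1 p.2.1 p.2.2.1 p.2.2.2)) := by
    by_cases h : kinded p
    · obtain ⟨n, hn⟩ := exists_answer (g := goal p) h.1.acc_smaller h.2.acc_smaller
      refine ⟨n, ?_⟩
      simp only [run, if_pos h, hn, Option.some.injEq, decide_eq_decide, subAt_iff]
      exact ⟨fun h' => ⟨h, h'⟩, fun h' => h'.2⟩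
    · refine ⟨0, ?_⟩
      simp only [run, if_neg h, Option.some.injEq]
      exact (decide_eq_false fun h' => h h'.2).symm
  obtain ⟨n, hn⟩ := total
  refine Part.eq_some_iff.2 ?_
  have dom := Nat.rfindOpt_dom.2 ⟨n, _, hn⟩
  obtain ⟨m, hm⟩ := Nat.rfindOpt_spec (Part.get_mem dom)
  -- The search may stop at another number of steps than the one exhibited; the answer is the same.
  have unique {m n : ℕ} {b c : Bool} (hb : run p m = some b) (hc : run p n = some c) : b = c := by
    simp only [run] at hb hc
    split_ifs at hb hc
    · exact answer_unique hb hc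
    · exact Option.some.inj (hb.symm.trans hc)
  have h := Part.get_mem dom
  rwa [unique hm hn] at h

end FOmegaSub

theorem mainTheorem11 :
    (∀ (Γ : FOmegaSub.Ctx) (A : FOmegaSub.Ty) (K : FOmegaSub.Knd),
      FOmegaSub.HasKind Γ A K → FOmegaSub.SN A) ∧
    ComputablePred (fun p : FOmegaSub.Ctx × FOmegaSub.Ty × FOmegaSub.Knd =>
      FOmegaSub.HasKind p.1 p.2.1 p.2.2) ∧
    ComputablePred (fun p : FOmegaSub.Ctx × FOmegaSub.Ty × FOmegaSub.Ty × FOmegaSub.Knd =>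
      FOmegaSub.SubAt p.1 p.2.1 p.2.2.1 p.2.2.2) ∧
    (∀ (Γ : FOmegaSub.Ctx) (A B : FOmegaSub.Ty) (K : FOmegaSub.Knd),
      FOmegaSub.Sub Γ A B → FOmegaSub.Sub Γ B A →
      FOmegaSub.HasKind Γ A K → FOmegaSub.HasKind Γ B K → FOmegaSub.BetaEq A B) :=
  ⟨fun _ _ _ h => (FOmegaSub.hasKind_iff.1 h).2.sn,
    FOmegaSub.primrecPred_hasKind.computablePred,
    FOmegaSub.computablePred_subAt,
    fun _ _ _ _ h h' hA hB => h.antisymm h' hA hB⟩
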